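/- Let $p$ be a prime number, $F$ a finite extension of $\mathbb{Q}_p$, $\mathcal{O}_F$ its ring of integers, $q$ the cardinality of its residue field, and $\bar F$ an algebraic closure of $F$. Let $\|\cdot\|$ be the $p$-adic norm on $\bar F$ normalized by $\|p\| = p^{-[F:\mathbb{Q}_p]}$. For a finite extension $K \subset \bar F$ of $F$, let $\mathcal{O}_K$ be its ring of integers, $\lambda_K$ (written $dt$ in integrals) the Haar measure on $K$ with $\lambda_K(\mathcal{O}_K)=1$, and $D_K$ the discriminant of $K/F$ (the determinant of the trace form in an $\mathcal{O}_F$-basis of $\mathcal{O}_K$). For $m \ge 0$ let $\Omega_m$ be the space of polynomials of degree at most $m$ with coefficients in $\mathcal{O}_F$, with the probability measure corresponding to $\lambda_F^{\otimes (m+1)}$ under $\Omega_m \simeq \mathcal{O}_F^{m+1}$. For a positive integer $n$ and a finite extension $K \subset \bar F$ of $F$ of degree $r$, the density function $\rho_{K,n} : K \to \mathbb{R}_{\ge 0}$ is defined as follows. For $x \in \mathcal{O}_K$, $$\rho_{K,n}(x) = \frac{\|D_K\|}{\#(\mathcal{O}_K/\mathcal{O}_F[x])} \int_{\Omega_{n-r}}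 \|Q(x)\|^r \, dQ \quad \text{if } n \ge r \text{ and } F[x]=K, \qquad \rho_{K,n}(x) = 0 \text{ otherwise};$$ for $x \in K \setminus \mathcal{O}_K$, $\rho_{K,n}(x) = \|x\|^{-2r} \rho_{K,n}(x^{-1})$. Theorem B. Let $n$ be a positive integer, let $K \subset \bar F$ be a finite extension of $F$ of degree $r$, and let $x \in K$. 1. (Vanishing) If $F[x] \neq K$ or $n < r$, then $\rho_{K,n}(x)=0$. 2. (Continuity) The function $\rho_{K,n}$ is continuous on $K$. 3. (Invariance under isomorphisms) For a second finite extension $L \subset \bar F$ of $F$ and an isomorphism of $F$-algebras $\sigma : K \to L$, we have $\rho_{K,n}(x) = \rho_{L,n}(\sigma(x))$. 4. (Transformation under homography) For $\begin{pmatrix} a & b \\ c & d \end{pmatrix} \in \mathrm{GL}_2(\mathcal{O}_F)$ with $cx+d \neq 0$, we have $$\rho_{K,n}\left(\frac{ax+b}{cx+d}\right) = \|cx+d\|^{2r} \cdot \rho_{K,n}(x).$$ 5. (Monotony) We have $\rho_{K,n}(x) \le \rho_{K,n+1}(x)$, and the inequality is strict if and only if $F[x]=K$ and $r-1 \le n <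 2r-1$. 6. (Formulas for extremal degrees) If $F[x]=K$ and $x \in \mathcal{O}_K$, then $$\rho_{K,r}(x) = \|D_K\| \cdot \frac{1}{\#(\mathcal{O}_K/\mathcal{O}_F[x])} \cdot \frac{q^{r+1}-q^r}{q^{r+1}-1},$$ $$\text{and, for } n \ge 2r-1, \quad \rho_{K,n}(x) = \|D_K\| \cdot \int_{\mathcal{O}_F[x]} \|t\|^r \, dt.$$ -/

import Mathlib

open MeasureTheory Polynomial

noncomputable section

section LocalField

variable (p : ℕ) [Fact p.Prime]
variable (L : Type*) [Field L] [Algebra ℚ_[p] L] [FiniteDimensional ℚ_[p] L]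

/-- The `p`-adic absolute value on a finite extension `L` of `ℚ_p` (the unique one that extends the
absolute value of `ℚ_p`), as a normed field structure. -/
@[reducible] def padicNormedField : NormedField L :=
  spectralNorm.normedField ℚ_[p] L

/-- The `p`-adic topology on a finite extension `L` of `ℚ_p`. -/
@[reducible] def padicTopology : TopologicalSpace L :=
  letI := padicNormedField p L
  inferInstance

/-- The Borel `σ`-algebra of the `p`-adic topology. -/
@[reducible] def padicBorel : MeasurableSpace L :=
  @borel L (padicTopology p L)

/-- The ring of integers `𝒪_L`, as a valuation subring of `L`: the elements of absolute value at
most `1`. -/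
def integerRing : ValuationSubring L :=
  letI := padicNormedField p L
  { carrier := {x : L | spectralNorm ℚ_[p] L x ≤ 1}
    mul_mem' := by
      intro a b ha hb
      change ‖a‖ ≤ 1 at ha
      change ‖b‖ ≤ 1 at hb
      change ‖a * b‖ ≤ 1
      rw [norm_mul]
      exact mul_le_one₀ ha (norm_nonneg b) hb
    one_mem' := by
      change ‖(1 : L)‖ ≤ 1
      simp
    add_mem' := by
      intro a b ha hb
      exact (isNonarchimedean_spectralNorm a b).trans (max_le ha hb)
    zero_mem' := by
      change ‖(0 : L)‖ ≤ 1
      simp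
    neg_mem' := by
      intro a ha
      change ‖a‖ ≤ 1 at ha
      change ‖-a‖ ≤ 1
      rwa [norm_neg]
    mem_or_inv_mem' := by
      intro a
      change ‖a‖ ≤ 1 ∨ ‖a⁻¹‖ ≤ 1
      rcases le_total ‖a‖ 1 with h | h
      · exact Or.inl h
      · right
        rw [norm_inv]
        exact inv_le_one_of_one_le₀ h }

/-- The Haar measure `λ_L` on `L`, normalized by `λ_L(𝒪_L) = 1`. The closed unit ball below is the
ring of integers `𝒪_L`. -/
def unitHaar : @Measure L (padicBorel p L) :=
  letI := spectralNorm.nontriviallyNormedField ℚ_[p] L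
  letI := spectralNorm.normedAlgebra ℚ_[p] L
  letI := padicBorel p L
  haveI : BorelSpace L := ⟨rfl⟩
  haveI : ProperSpace L := FiniteDimensional.proper ℚ_[p] L
  Measure.addHaarMeasure
    { carrier := Metric.closedBall (0 : L) 1
      isCompact' := isCompact_closedBall 0 1
      interior_nonempty' :=
        ⟨0, mem_interior_iff_mem_nhds.2 (Metric.closedBall_mem_nhds 0 one_pos)⟩ }

/-- The cardinality `q` of the residue field of `L`. -/
def residueCard : ℕ :=
  Nat.card (IsLocalRing.ResidueField (integerRing p L))

end LocalField

section Extension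

variable (p : ℕ) [Fact p.Prime]
variable (F : Type*) [Field F] [Algebra ℚ_[p] F] [FiniteDimensional ℚ_[p] F]

/-- The `p`-adic norm on a finite extension `K` of `F`, normalized by `‖p‖ = p ^ (-[F : ℚ_p])`. -/
def extNorm {K : Type*} [Field K] [Algebra ℚ_[p] K] (x : K) : ℝ :=
  spectralNorm ℚ_[p] K x ^ Module.finrank ℚ_[p] F

/-- The probability measure `μ_m` on the space `Ω_m` of polynomials of degree at most `m` with
coefficients in `𝒪_F`, where a polynomial `a₀ + a₁ X + ⋯ + a_m X ^ m` is identified with the vector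
`(a₀, …, a_m)` of its coefficients: the product measure `λ_F ^ (m + 1)` on `𝒪_F ^ (m + 1)`. -/
def polyMeasure (m : ℕ) :
    @Measure (Fin (m + 1) → F) (@MeasurableSpace.pi _ _ fun _ => padicBorel p F) :=
  letI := padicBorel p F
  Measure.pi fun _ : Fin (m + 1) => (unitHaar p F).restrict (integerRing p F : Set F)

/-- The polynomial `a₀ + a₁ X + ⋯ + a_m X ^ m` with coefficient vector `a`. -/
def coeffPoly {F : Type*} [Field F] {m : ℕ} (a : Fin (m + 1) → F) : F[X] :=
  ∑ i : Fin (m + 1), C (a i) * X ^ (i : ℕ)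

variable (K : Type*) [Field K] [Algebra ℚ_[p] K] [FiniteDimensional ℚ_[p] K] [Algebra F K]

/-- The `F`-basis `b` of `K` is a basis of `𝒪_K` over `𝒪_F`: the elements of `𝒪_K` are those whose
coordinates in `b` lie in `𝒪_F`. -/
def IsIntegralBasis (b : Module.Basis (Fin (Module.finrank F K)) F K) : Prop :=
  ∀ y : K, y ∈ integerRing p K ↔ ∀ i, b.repr y i ∈ integerRing p F

open Classical in
/-- The discriminant `D_K` of the extension `K/F`: the determinant of the matrix
`(Tr_{K/F}(b_i b_j))` for a basis `b` of `𝒪_K` over `𝒪_F`. It depends on the choice of `b` only up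
to the square of a unit of `𝒪_F`. (Such a basis exists; the value `0` is never taken.) -/
def extDiscr : F :=
  if h : ∃ b : Module.Basis (Fin (Module.finrank F K)) F K, IsIntegralBasis p F K b then
    Algebra.discr F h.choose
  else 0

variable {K}

/-- The subring `𝒪_F[x]` of `K` generated by `𝒪_F` and `x`. -/
def integerAdjoin (x : K) : Subalgebra (integerRing p F) K :=
  Algebra.adjoin (integerRing p F) {x}

/-- The cardinality of the quotient `𝒪_K / 𝒪_F[x]` (for `x` in `𝒪_K`). -/
def integerIndex (x : K) : ℕ :=
  (integerAdjoin p F x).toSubring.toAddSubgroup.relIndex (integerRing p K).toSubring.toAddSubgroup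

open Classical in
/-- The density function on `𝒪_K`:
`‖D_K‖ / #(𝒪_K / 𝒪_F[x]) * ∫_{Ω_{n-r}} ‖Q(x)‖ ^ r dQ` if `n ≥ r` and `F[x] = K`, and `0` otherwise,
where `r = [K : F]`. -/
def integralDensity (n : ℕ) (x : K) : ℝ :=
  letI := padicBorel p F
  if Module.finrank F K ≤ n ∧ Algebra.adjoin F {x} = ⊤ then
    extNorm p F (extDiscr p F K) / integerIndex p F x *
      ∫ a, extNorm p F (aeval x (coeffPoly a)) ^ Module.finrank F K
        ∂(polyMeasure p F (n - Module.finrank F K))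
  else 0

open Classical in
/-- The density function `ρ_{K,n} : K → ℝ`. It is extended from `𝒪_K` to `K` by
`ρ_{K,n}(x) = ‖x‖ ^ (-2 r) * ρ_{K,n}(x⁻¹)`. -/
def rootDensity (n : ℕ) (x : K) : ℝ :=
  if x ∈ integerRing p K then integralDensity p F n x
  else (extNorm p F x ^ (2 * Module.finrank F K))⁻¹ * integralDensity p F n x⁻¹

/-- The integral `∫_{𝒪_F[x]} ‖t‖ ^ r dt` with respect to `λ_K`, where `r = [K : F]`. -/
def adjoinIntegral (x : K) : ℝ :=
  letI := padicBorel p K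
  ∫ t in (integerAdjoin p F x : Set K), extNorm p F t ^ Module.finrank F K ∂(unitHaar p K)

end Extension

/-- A finite extension of a finite extension of `ℚ_p` is finite over `ℚ_p`. -/
instance finiteDimensional_padic_intermediateField (p : ℕ) [Fact p.Prime]
    (F : Type*) [Field F] [Algebra ℚ_[p] F] [FiniteDimensional ℚ_[p] F]
    (Fbar : Type*) [Field Fbar] [Algebra ℚ_[p] Fbar] [Algebra F Fbar] [IsScalarTower ℚ_[p] F Fbar]
    (K : IntermediateField F Fbar) [FiniteDimensional F K] : FiniteDimensional ℚ_[p] K :=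
  FiniteDimensional.trans ℚ_[p] F K

end

/-! Write r = [K:F], e = [K:ℚ_p], and |·| for the absolute value extending that of ℚ_p, so that
‖t‖^r = |t|^e on K. Two functions of x carry the proof: V(x), the Haar volume of the lattice of
values at x of integral polynomials of degree less than r (`latticeVolume`), and J_m(x), the mean of
|Q(x)|^e over integral polynomials Q of degree at most m (`moment`). If x is integral and F[x] = K,
the lattice is 𝒪_F[x], so V(x) is the inverse of its index in 𝒪_K; if F[x] ≠ K, it lies in a proper
subspace and V(x) = 0. Hence for n ≥ r one formula covers all x (`rootDensity_eq`): ρ_{K,n}(x) =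
‖D_K‖ V(x) J_{n-r}(x) / max(1,|x|)^{e(n+1)}.

Continuity can be read off it: J is a parametric integral over a compact set, and V is a constant
times a power of the absolute value of the determinant of 1, x, …, x^{r-1} in a basis. For
homographies, GL₂(𝒪_F) acts on integral polynomials of bounded degree by measure preserving
bijections, so V and J are homogeneous of degrees e(r-1) and e(n-r) in cx+d. The denominator has
degree e(n+1), and the difference 2e is the required exponent.

Monotony comes from conditioning on the leading coefficient. Adding a constant s to Q(x) cannot
decrease the moment: after an integral translation of Q, s has least norm in its class modulo the
lattice of values, and then |Q(x)+s| = max(|Q(x)|,|s|). The increase is strict when s is outside the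
lattice. A new leading term stays outside while the powers of x are independent, and lies inside
once the degree reaches r, by division by the integral minimal polynomial.

For n = r, J_0 is an integral over 𝒪_F, found from its self-similarity under a uniformizer. For n ≥
2r-1 the moments have stabilised at J_{r-1}, which is the average of |t|^e over 𝒪_F[x], so V J_{r-1}
is the stated integral. Invariance under isomorphisms holds since every ingredient is determined by
the F-algebra structure. -/

noncomputable section

/-! ### Scaling of Haar measures -/

section Scaling
open scoped Pointwise NNReal ENNReal

/-- The larger group is a finite disjoint union of translates of the smaller one. This turns indices
into quotients of volumes. -/
theorem measure_addSubgroup_eq_relIndex_mul {G : Type*} [AddCommGroup G] [MeasurableSpace G]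
    [MeasurableAdd G] (μ : Measure G) [μ.IsAddLeftInvariant] {H L : AddSubgroup G} (hHL : H ≤ L)
    (hH : MeasurableSet (H : Set G)) (hfin : H.relIndex L ≠ 0) :
    μ L = H.relIndex L * μ H := by
  have : (H.addSubgroupOf L).FiniteIndex := ⟨hfin⟩
  obtain ⟨s, hs, -⟩ := (H.addSubgroupOf L).exists_isComplement_left 0
  have hs' : Finite s := hs.finite_left_iff.mpr inferInstance
  have key : (L : Set G) = ⋃ a : s, ((a : L) : G) +ᵥ (H : Set G) := by
    ext y
    simp only [SetLike.mem_coe, Set.mem_iUnion]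
    constructor
    · intro hy
      have h1 : (⟨y, hy⟩ : L) ∈ s + ((H.addSubgroupOf L : AddSubgroup L) : Set L) := by
        rw [hs.add_eq]; trivial
      obtain ⟨a, ha, b, hb, hab⟩ := Set.mem_add.1 h1
      refine ⟨⟨a, ha⟩, Set.mem_vadd_set.2 ⟨b, hb, ?_⟩⟩
      simpa using congrArg Subtype.val hab
    · rintro ⟨a, ha⟩
      obtain ⟨b, hb, rfl⟩ := Set.mem_vadd_set.1 ha
      exact L.add_mem a.1.2 (hHL hb)
  have hd : Pairwise (Function.onFun Disjoint fun a : s => ((a : L) : G) +ᵥ (H : Set G)) := by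
    intro a b hab
    have h1 := hs.pairwiseDisjoint_vadd a.2 b.2 (Subtype.val_injective.ne hab)
    rw [Function.onFun, Set.disjoint_left] at h1 ⊢
    intro y hya hyb
    obtain ⟨u, hu, rfl⟩ := Set.mem_vadd_set.1 hya
    obtain ⟨v, hv, huv⟩ := Set.mem_vadd_set.1 hyb
    refine h1 (Set.mem_vadd_set.2 ⟨⟨u, hHL hu⟩, hu, rfl⟩)
      (Set.mem_vadd_set.2 ⟨⟨v, hHL hv⟩, hv, Subtype.ext huv⟩)
  rw [key, measure_iUnion hd fun _ => hH.const_vadd _]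
  simp [measure_vadd, hs.encard_left, AddSubgroup.relIndex]

/-- The quotient of a compact group by an open subgroup is compact and discrete, hence finite. -/
theorem relIndex_ne_zero_of_isOpen_of_isCompact {G : Type*} [AddCommGroup G] [TopologicalSpace G]
    [IsTopologicalAddGroup G] {H L : AddSubgroup G} (hH : IsOpen (H : Set G))
    (hL : IsCompact (L : Set G)) : H.relIndex L ≠ 0 := by
  have : CompactSpace L := isCompact_iff_compactSpace.1 hL
  have ho : IsOpen ((H.addSubgroupOf L : AddSubgroup L) : Set L) :=
    hH.preimage continuous_subtype_val
  have := AddSubgroup.quotient_finite_of_isOpen _ ho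
  exact AddSubgroup.finiteIndex_of_finite_quotient.index_ne_zero

theorem Units.smul_closedBall_zero {K : Type*} [NormedField K] (u : Kˣ) (R : ℝ) :
    u • Metric.closedBall (0 : K) R = Metric.closedBall (0 : K) (‖(u : K)‖ * R) := by
  ext y
  rw [Set.mem_smul_set_iff_inv_smul_mem]
  change ((u⁻¹ : Kˣ) : K) * y ∈ _ ↔ _
  rw [mem_closedBall_zero_iff, mem_closedBall_zero_iff, norm_mul,
    Units.val_inv_eq_inv_val, norm_inv]
  rw [inv_mul_le_iff₀ (by simp)]

variable {p : ℕ} [Fact p.Prime]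

/-- The integers 0, …, p-1 represent the cosets of pℤ_p in ℤ_p. -/
theorem Padic.measure_closedBall_one_eq_mul [MeasurableSpace ℚ_[p]] [BorelSpace ℚ_[p]]
    (μ : Measure ℚ_[p]) [μ.IsAddHaarMeasure] :
    μ (Metric.closedBall 0 1) = p * μ (Metric.closedBall 0 (p : ℝ)⁻¹) := by
  have hp := (Fact.out : p.Prime)
  have key : Metric.closedBall (0 : ℚ_[p]) 1 =
      ⋃ i : Fin p, ((i : ℕ) : ℚ_[p]) +ᵥ Metric.closedBall (0 : ℚ_[p]) (p : ℝ)⁻¹ := by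
    ext y
    simp only [Set.mem_iUnion, Set.mem_vadd_set_iff_neg_vadd_mem, mem_closedBall_zero_iff,
      vadd_eq_add]
    constructor
    · intro hy
      obtain ⟨z, rfl⟩ : ∃ z : ℤ_[p], (z : ℚ_[p]) = y := ⟨⟨y, hy⟩, rfl⟩
      obtain ⟨n, hn, h⟩ := PadicInt.exists_mem_range z
      refine ⟨⟨n, hn⟩, ?_⟩
      rw [PadicInt.maximalIdeal_eq_span_p, ← pow_one (p : ℤ_[p]),
        ← PadicInt.norm_le_pow_iff_mem_span_pow] at h
      rw [neg_add_eq_sub]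
      rwa [PadicInt.norm_def, PadicInt.coe_sub, PadicInt.coe_natCast, Nat.cast_one,
        zpow_neg_one] at h
    · rintro ⟨i, hi⟩
      have h1 : ‖((i : ℕ) : ℚ_[p])‖ ≤ 1 := by
        exact_mod_cast Padic.norm_int_le_one (p := p) (i : ℕ)
      have h2 : y = ((i : ℕ) : ℚ_[p]) + (-((i : ℕ) : ℚ_[p]) + y) := by ring
      rw [h2]
      refine (IsUltrametricDist.norm_add_le_max _ _).trans (max_le h1 (hi.trans ?_))
      exact inv_le_one_of_one_le₀ (by exact_mod_cast hp.one_lt.le)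
  have hd : Pairwise (Function.onFun Disjoint fun i : Fin p =>
      ((i : ℕ) : ℚ_[p]) +ᵥ Metric.closedBall (0 : ℚ_[p]) (p : ℝ)⁻¹) := by
    intro i j hij
    rw [Function.onFun, Set.disjoint_left]
    intro y hi hj
    simp only [Set.mem_vadd_set_iff_neg_vadd_mem, mem_closedBall_zero_iff, vadd_eq_add] at hi hj
    have h1 : ‖((((i : ℕ) : ℤ) - ((j : ℕ) : ℤ) : ℤ) : ℚ_[p])‖ < 1 := by
      have h2 : ((((i : ℕ) : ℤ) - ((j : ℕ) : ℤ) : ℤ) : ℚ_[p]) =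
          (-((j : ℕ) : ℚ_[p]) + y) + -(-((i : ℕ) : ℚ_[p]) + y) := by push_cast; ring
      rw [h2]
      refine (IsUltrametricDist.norm_add_le_max _ _).trans_lt ?_
      rw [norm_neg]
      exact (max_le hj hi).trans_lt (inv_lt_one_of_one_lt₀ (by exact_mod_cast hp.one_lt))
    rw [Padic.norm_intCast_lt_one_iff] at h1
    have h3 := Int.eq_zero_of_abs_lt_dvd h1 (by have := i.2; have := j.2; rw [abs_lt]; omega)
    exact hij (Fin.ext (by omega))
  rw [key, measure_iUnion hd fun _ => Metric.isClosed_closedBall.measurableSet.const_vadd _]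
  simp only [measure_vadd, tsum_fintype, Finset.sum_const, Finset.card_univ, Fintype.card_fin,
    nsmul_eq_mul]


theorem distribHaarChar_units_of_norm_eq_one {K : Type*} [NormedField K] [ProperSpace K]
    (u : Kˣ) (hu : ‖(u : K)‖ = 1) : distribHaarChar K u = 1 := by
  borelize K
  have h0 : (Measure.addHaar : Measure K) (Metric.closedBall 0 1) ≠ 0 :=
    (Metric.measure_closedBall_pos _ _ one_pos).ne'
  refine distribHaarChar_eq_of_measure_smul_eq_mul (μ := Measure.addHaar) h0
    (isCompact_closedBall _ _).measure_lt_top.ne ?_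
  rw [Units.smul_closedBall_zero, hu, one_mul, ENNReal.coe_one, one_mul]

theorem Padic.distribHaarChar_prime (u : ℚ_[p]ˣ) (hu : (u : ℚ_[p]) = p) :
    distribHaarChar ℚ_[p] u = (p : ℝ≥0)⁻¹ := by
  borelize ℚ_[p]
  have hp := (Fact.out : p.Prime)
  have h0 : (Measure.addHaar : Measure ℚ_[p]) (Metric.closedBall 0 1) ≠ 0 :=
    (Metric.measure_closedBall_pos _ _ one_pos).ne'
  refine distribHaarChar_eq_of_measure_smul_eq_mul (μ := Measure.addHaar) h0
    (isCompact_closedBall _ _).measure_lt_top.ne ?_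
  rw [Units.smul_closedBall_zero, hu, mul_one, Padic.norm_p,
    Padic.measure_closedBall_one_eq_mul, ← mul_assoc, ENNReal.coe_inv (by exact_mod_cast hp.ne_zero),
    ENNReal.coe_natCast, ENNReal.inv_mul_cancel (by exact_mod_cast hp.ne_zero) (by simp), one_mul]

/-- In linear coordinates the scalar acts on each factor separately; the modulus is measured on a
product of unit balls. -/
theorem distribHaarChar_smul_finiteDimensional {F V : Type*} [NontriviallyNormedField F]
    [ProperSpace F] [NormedAddCommGroup V] [NormedSpace F V] [FiniteDimensional F V]
    [ProperSpace V] (u : Fˣ) :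
    distribHaarChar V u = distribHaarChar F u ^ Module.finrank F V := by
  borelize F V
  set d := Module.finrank F V
  have : SecondCountableTopology F := secondCountable_of_proper
  let e : (Fin d → F) ≃L[F] V := ContinuousLinearEquiv.ofFinrankEq (by simp [d])
  let ν : Measure (Fin d → F) := Measure.pi fun _ => Measure.addHaar
  have hν : (ν.map e).IsAddHaarMeasure := e.isAddHaarMeasure_map ν
  let B : Set (Fin d → F) := Set.univ.pi fun _ => Metric.closedBall 0 1
  have hB : ∀ S : Set (Fin d → F), (ν.map e) (e '' S) = ν S := by
    intro S
    have : (ν.map e) (e '' S) = (ν.map e.toHomeomorph.toMeasurableEquiv) (e '' S) := rfl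
    rw [this, MeasurableEquiv.map_apply]
    congr 1
    exact Set.preimage_image_eq _ e.injective
  have h0 : (Measure.addHaar : Measure F) (Metric.closedBall 0 1) ≠ 0 :=
    (Metric.measure_closedBall_pos _ _ one_pos).ne'
  have h1 : (Measure.addHaar : Measure F) (Metric.closedBall 0 1) ≠ ⊤ :=
    (isCompact_closedBall _ _).measure_lt_top.ne
  have hνB : ν B = (Measure.addHaar : Measure F) (Metric.closedBall 0 1) ^ d := by
    simp [ν, B, Measure.pi_pi]
  refine distribHaarChar_eq_of_measure_smul_eq_mul (μ := ν.map e) (s := e '' B) ?_ ?_ ?_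
  · rw [hB, hνB]; exact pow_ne_zero _ h0
  · rw [hB, hνB]; exact ENNReal.pow_ne_top h1
  · have h2 : u • (e '' B) = e '' (Set.univ.pi fun _ => u • Metric.closedBall (0 : F) 1) := by
      ext y
      rw [Set.mem_smul_set_iff_inv_smul_mem]
      constructor
      · rintro ⟨b, hb, hby⟩
        refine ⟨u • b, fun i hi => Set.smul_mem_smul_set (hb i hi), ?_⟩
        rw [Units.smul_def, map_smul, hby, ← Units.smul_def, smul_inv_smul]
      · rintro ⟨b, hb, rfl⟩
        refine ⟨u⁻¹ • b, fun i hi => Set.mem_smul_set_iff_inv_smul_mem.1 (hb i hi), ?_⟩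
        rw [Units.smul_def, map_smul, ← Units.smul_def]
    rw [h2, hB, hB, hνB]
    simp only [ν, Measure.pi_pi, Finset.prod_const, Finset.card_univ, Fintype.card_fin]
    rw [← distribHaarChar_mul, mul_pow, ENNReal.coe_pow]

variable (p) in
-- The modulus is a character that is trivial on elements of norm one and known on p. Some power of
-- u differs from a power of p by an element of norm one, and nonnegative reals have unique roots.
theorem distribHaarChar_eq_nnnorm_pow {K : Type*} [NormedField K] [NormedAlgebra ℚ_[p] K]
    [FiniteDimensional ℚ_[p] K] [ProperSpace K] (u : Kˣ) :
    distribHaarChar K u = ‖(u : K)‖₊ ^ Module.finrank ℚ_[p] K := by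
  have hp := (Fact.out : p.Prime)
  have hpQ : (p : ℚ_[p]) ≠ 0 := by exact_mod_cast hp.ne_zero
  set d := Module.finrank ℚ_[p] K
  let P : ℚ_[p]ˣ := Units.mk0 p hpQ
  let PK : Kˣ := Units.map (algebraMap ℚ_[p] K : ℚ_[p] →* K) P
  have hPK : ∀ x : K, PK • x = P • x := by
    intro x
    simp [PK, Units.smul_def, Algebra.smul_def]
  have hχP : distribHaarChar K PK = (p : ℝ≥0)⁻¹ ^ d := by
    have h1 : distribHaarChar K PK = distribHaarChar K P := by
      borelize K
      have h0 : (Measure.addHaar : Measure K) (Metric.closedBall 0 1) ≠ 0 :=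
        (Metric.measure_closedBall_pos _ _ one_pos).ne'
      refine distribHaarChar_eq_of_measure_smul_eq_mul (μ := Measure.addHaar) h0
        (isCompact_closedBall _ _).measure_lt_top.ne ?_
      rw [distribHaarChar_mul]
      congr 1
      ext y
      simp only [Set.mem_smul_set, hPK]
    rw [h1, distribHaarChar_smul_finiteDimensional, Padic.distribHaarChar_prime P rfl]
  have hu0 : (u : K) ≠ 0 := u.ne_zero
  set c := (minpoly ℚ_[p] (u : K)).coeff 0
  set m := (minpoly ℚ_[p] (u : K)).natDegree
  have hint : IsIntegral ℚ_[p] (u : K) := Algebra.IsIntegral.isIntegral _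
  have hm : m ≠ 0 := (minpoly.natDegree_pos hint).ne'
  have hc : c ≠ 0 := (minpoly.coeff_zero_ne_zero hint) hu0
  -- The norm of u is the m-th root of the norm of the constant term c of its minimal polynomial.
  -- Since c lies in ℚ_p, its norm is a power of p.
  have hnorm : ‖(u : K)‖ ^ m = ‖c‖ := by
    rw [NormedAlgebra.norm_eq_spectralNorm ℚ_[p], spectralNorm.spectralNorm_eq_norm_coeff_zero_rpow,
      ← Real.rpow_natCast, ← Real.rpow_mul (norm_nonneg _), one_div,
      inv_mul_cancel₀ (by exact_mod_cast hm), Real.rpow_one]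
  set k := c.valuation
  have hck : ‖c‖ = (p : ℝ) ^ (-k) := Padic.norm_eq_zpow_neg_valuation hc
  have hnP : ‖(PK : K)‖ = (p : ℝ)⁻¹ := by
    rw [show (PK : K) = algebraMap ℚ_[p] K p from rfl, norm_algebraMap', Padic.norm_p]
  have hp0 : (p : ℝ) ≠ 0 := by exact_mod_cast hp.ne_zero
  have h1 : distribHaarChar K (u ^ m * PK ^ (-k)) = 1 := by
    refine distribHaarChar_units_of_norm_eq_one _ ?_
    rw [Units.val_mul, Units.val_pow_eq_pow_val, norm_mul, norm_pow, hnorm, hck,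
      Units.val_zpow_eq_zpow_val, norm_zpow, hnP, ← inv_zpow', inv_zpow', inv_zpow', neg_neg, zpow_neg]
    exact inv_mul_cancel₀ (zpow_ne_zero _ hp0)
  rw [map_mul, map_pow, map_zpow, hχP] at h1
  have h2 : distribHaarChar K u ^ m = (‖(u : K)‖₊ ^ d) ^ m := by
    have h3 : ((p : ℝ≥0)⁻¹ ^ d) ^ (-k) ≠ 0 := by
      refine zpow_ne_zero _ (pow_ne_zero _ (inv_ne_zero (by exact_mod_cast hp.ne_zero)))
    refine mul_right_cancel₀ h3 (h1.trans ?_)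
    have h4 : ‖(u : K)‖₊ ^ m = (p : ℝ≥0)⁻¹ ^ k := by
      ext
      push_cast
      rw [hnorm, hck, inv_zpow']
    have h5 : (p : ℝ≥0)⁻¹ ≠ 0 := inv_ne_zero (by exact_mod_cast hp.ne_zero)
    rw [← pow_mul, mul_comm d m, pow_mul, h4, ← zpow_natCast, ← zpow_natCast, ← zpow_mul,
      ← zpow_mul, ← zpow_add₀ h5]
    simp [mul_comm]
  exact (pow_left_inj₀ zero_le zero_le hm).1 h2

theorem measure_preimage_mul_left_eq {K : Type*} [NormedField K] [NormedAlgebra ℚ_[p] K]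
    [FiniteDimensional ℚ_[p] K] [ProperSpace K] [MeasurableSpace K] [BorelSpace K] (μ : Measure K)
    [μ.IsAddHaarMeasure] {a : K} (ha : a ≠ 0) (s : Set K) :
    μ ((a * ·) ⁻¹' s) = ((‖a‖₊ ^ Module.finrank ℚ_[p] K)⁻¹ : ℝ≥0) * μ s := by
  have h1 : (a * ·) ⁻¹' s = (Units.mk0 a ha)⁻¹ • s := by
    ext y
    rw [Set.mem_smul_set_iff_inv_smul_mem, inv_inv]
    rfl
  rw [h1, ← distribHaarChar_mul, map_inv, distribHaarChar_eq_nnnorm_pow p, Units.val_mk0]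

theorem measure_image_mul_left_eq {K : Type*} [NormedField K] [NormedAlgebra ℚ_[p] K]
    [FiniteDimensional ℚ_[p] K] [ProperSpace K] [MeasurableSpace K] [BorelSpace K] (μ : Measure K)
    [μ.IsAddHaarMeasure] {a : K} (ha : a ≠ 0) (s : Set K) :
    μ ((a * ·) '' s) = (‖a‖₊ ^ Module.finrank ℚ_[p] K : ℝ≥0) * μ s := by
  have h1 : (a * ·) '' s = (Units.mk0 a ha) • s := rfl
  rw [h1, ← distribHaarChar_mul, distribHaarChar_eq_nnnorm_pow p, Units.val_mk0]

/-! ### Linear changes of variables on a power of F -/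

section Transvection

variable {F : Type*} [NontriviallyNormedField F] [MeasurableSpace F] [BorelSpace F]
  {ι : Type*} [Fintype ι] [DecidableEq ι]

theorem measurable_toLin' [SecondCountableTopology F] (M : Matrix ι ι F) :
    Measurable (Matrix.toLin' M) :=
  (LinearMap.continuous_on_pi _).measurable

/-- A transvection translates one coordinate by an amount depending on another. Integrating the
translated coordinate first removes the shift. -/
theorem map_transvection_pi_haar [ProperSpace F] (μ : Measure F)
    [μ.IsAddHaarMeasure] (t : Matrix.TransvectionStruct ι F) :
    (Measure.pi fun _ : ι => μ).map (Matrix.toLin' t.toMatrix) = Measure.pi fun _ : ι => μ := by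
  have : SecondCountableTopology F := secondCountable_of_proper
  have ht : Measurable (Matrix.toLin' t.toMatrix) := measurable_toLin' _
  refine (Measure.pi_eq fun s hs => ?_).symm
  have h2s : MeasurableSet (Set.univ.pi s) := .pi Set.countable_univ fun i _ => hs i
  simp_rw [← Measure.pi_pi, ← lintegral_indicator_one h2s]
  rw [lintegral_map (measurable_one.indicator h2s) ht]
  refine lintegral_eq_of_lmarginal_eq {t.i} ((measurable_one.indicator h2s).comp ht)
    (measurable_one.indicator h2s) ?_
  simp_rw [lmarginal_singleton]
  ext x
  cases t with | mk t_i t_j t_hij t_c =>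
  simp [Matrix.transvection, Matrix.single_mulVec, t_hij.symm, ← Function.update_add,
    lintegral_add_right_eq_self fun xᵢ => Set.indicator (Set.univ.pi s) 1 (Function.update x t_i xᵢ)]

end Transvection

section Det

variable {F : Type*} [NontriviallyNormedField F] [NormedAlgebra ℚ_[p] F] [FiniteDimensional ℚ_[p] F]
  [ProperSpace F] [MeasurableSpace F] [BorelSpace F] (μ : Measure F) [μ.IsAddHaarMeasure]
  {ι : Type*} [Fintype ι] [DecidableEq ι]

theorem map_diagonal_pi_haar {D : ι → F} (h : (Matrix.diagonal D).det ≠ 0) :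
    (Measure.pi fun _ : ι => μ).map (Matrix.toLin' (Matrix.diagonal D)) =
      ((‖(Matrix.diagonal D).det‖₊ ^ Module.finrank ℚ_[p] F)⁻¹ : ℝ≥0) •
        Measure.pi fun _ : ι => μ := by
  have : SecondCountableTopology F := secondCountable_of_proper
  rw [Matrix.det_diagonal] at h ⊢
  have hD : ∀ i, D i ≠ 0 := fun i => Finset.prod_ne_zero_iff.1 h i (Finset.mem_univ i)
  have hc : (‖∏ i, D i‖₊ ^ Module.finrank ℚ_[p] F : ℝ≥0) ≠ 0 :=
    pow_ne_zero _ (nnnorm_ne_zero_iff.2 h)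
  have key : (‖∏ i, D i‖₊ ^ Module.finrank ℚ_[p] F : ℝ≥0) •
      (Measure.pi fun _ : ι => μ).map (Matrix.toLin' (Matrix.diagonal D)) =
        Measure.pi fun _ : ι => μ := by
    refine (Measure.pi_eq fun s hs => ?_).symm
    rw [Measure.smul_apply, Measure.map_apply (measurable_toLin' _) (MeasurableSet.univ_pi hs)]
    have h1 : (Matrix.toLin' (Matrix.diagonal D) ⁻¹' Set.pi Set.univ fun i : ι => s i) =
        Set.pi Set.univ fun i : ι => (D i * ·) ⁻¹' s i := by
      ext f
      simp [Matrix.diagonal_toLin']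
    rw [h1, Measure.pi_pi, nnnorm_prod, ← Finset.prod_pow, ENNReal.smul_def, ENNReal.ofNNReal_finsetProd,
      smul_eq_mul, ← Finset.prod_mul_distrib]
    refine Finset.prod_congr rfl fun i _ => ?_
    rw [measure_preimage_mul_left_eq (p := p) μ (hD i), ← mul_assoc, ← ENNReal.coe_mul,
      mul_inv_cancel₀ (pow_ne_zero _ (nnnorm_ne_zero_iff.2 (hD i))), ENNReal.coe_one, one_mul]
  conv_rhs => rw [← key, smul_smul, inv_mul_cancel₀ hc, one_smul]

/-- An invertible matrix rescales the Haar measure by the normalized absolute value of its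
determinant. -/
theorem map_matrix_pi_haar {M : Matrix ι ι F} (hM : M.det ≠ 0) :
    (Measure.pi fun _ : ι => μ).map (Matrix.toLin' M) =
      ((‖M.det‖₊ ^ Module.finrank ℚ_[p] F)⁻¹ : ℝ≥0) • Measure.pi fun _ : ι => μ := by
  have : SecondCountableTopology F := secondCountable_of_proper
  -- Invertible matrices are generated by transvections and invertible diagonal matrices, and the
  -- scaling factor is multiplicative.
  refine Matrix.diagonal_transvection_induction_of_det_ne_zero (fun M : Matrix ι ι F =>
    (Measure.pi fun _ : ι => μ).map (Matrix.toLin' M) =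
      ((‖M.det‖₊ ^ Module.finrank ℚ_[p] F)⁻¹ : ℝ≥0) • Measure.pi fun _ : ι => μ) M hM
    (fun D hD => map_diagonal_pi_haar μ hD) (fun t => ?_) fun A B _ _ hA hB => ?_
  · rw [map_transvection_pi_haar]
    simp
  · rw [Matrix.toLin'_mul, Matrix.det_mul, LinearMap.coe_comp,
      ← Measure.map_map (measurable_toLin' _) (measurable_toLin' _), hB, Measure.map_smul, hA,
      smul_smul, nnnorm_mul, mul_pow, mul_inv, mul_comm]

end Det

/-- A compact subset of a proper subspace has Haar measure zero. -/
theorem measure_eq_zero_of_subset_submodule {F K : Type*} [NontriviallyNormedField F]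
    [NormedAddCommGroup K] [NormedSpace F K] [ProperSpace K] [MeasurableSpace K] [BorelSpace K]
    (μ : Measure K) [μ.IsAddHaarMeasure] {W : Submodule F K} (hW : W ≠ ⊤) {S : Set K}
    (hS : MeasurableSet S) (hSW : S ⊆ W) : μ S = 0 := by
  by_contra h
  apply hW
  -- Steinhaus: differences of a set of positive measure fill a neighbourhood of 0, and a subspace
  -- with nonempty interior is everything.
  have h1 : S - S ∈ nhds (0 : K) :=
    Measure.sub_mem_nhds_zero_of_addHaar_pos μ S hS (pos_iff_ne_zero.2 h)
  have h2 : (W : Set K) ∈ nhds (0 : K) := by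
    refine Filter.mem_of_superset h1 ?_
    rintro _ ⟨a, ha, b, hb, rfl⟩
    exact W.sub_mem (hSW ha) (hSW hb)
  refine Submodule.eq_top_of_nonempty_interior' _ ⟨0, mem_interior_iff_mem_nhds.2 h2⟩

end Scaling

/-! ### Evaluation of polynomials and the action of homographies -/

section Evaluation

/-- The evaluation at `x` of the polynomial of degree at most `m` with a given coefficient vector,
as a linear map. -/
def evalCoeff {F K : Type*} [Field F] [Field K] [Algebra F K] (x : K) (m : ℕ) :
    (Fin (m + 1) → F) →ₗ[F] K where
  toFun a := aeval x (coeffPoly a)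
  map_add' a b := by
    simp only [coeffPoly, Pi.add_apply, add_mul, Finset.sum_add_distrib, map_add]
  map_smul' c a := by
    simp only [coeffPoly, Pi.smul_apply, smul_eq_mul, mul_assoc, ← Finset.mul_sum, map_mul,
      aeval_C, RingHom.id_apply, Algebra.smul_def]

theorem evalCoeff_apply {F K : Type*} [Field F] [Field K] [Algebra F K] (x : K) (m : ℕ)
    (a : Fin (m + 1) → F) : evalCoeff x m a = ∑ i, algebraMap F K (a i) * x ^ (i : ℕ) := by
  simp [evalCoeff, coeffPoly, map_sum]

theorem coeffPoly_eq_of_natDegree_le {F : Type*} [Field F] {m : ℕ} {P : F[X]}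
    (hP : P.natDegree ≤ m) : coeffPoly (fun i : Fin (m + 1) => P.coeff i) = P := by
  rw [coeffPoly, Fin.sum_univ_eq_sum_range (fun i => C (P.coeff i) * X ^ i) (m + 1)]
  exact (P.as_sum_range_C_mul_X_pow' (Nat.lt_succ_of_le hP)).symm

theorem coeffPoly_injective {F : Type*} [Field F] {m : ℕ} :
    Function.Injective (coeffPoly : (Fin (m + 1) → F) → F[X]) := by
  intro a b h
  ext i
  have h1 : ∀ c : Fin (m + 1) → F, (coeffPoly c).coeff i = c i := by
    intro c
    simp [coeffPoly, finsetSum_coeff, coeff_X_pow, Fin.val_inj, Finset.sum_ite_eq]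
  rw [← h1 a, ← h1 b, h]

section Homography

variable {F : Type*} [Field F]

/-- The action of the matrix `(a, b; c, d)` on polynomials of degree at most `m`, that is
`Q ↦ (c X + d) ^ m Q((a X + b) / (c X + d))`, in terms of coefficient vectors. -/
def homographyMatrix (a b c d : F) (m : ℕ) : Matrix (Fin (m + 1)) (Fin (m + 1)) F :=
  Matrix.of fun j i =>
    ((C a * X + C b) ^ (i : ℕ) * (C c * X + C d) ^ (m - (i : ℕ))).coeff (j : ℕ)

theorem natDegree_linear_pow_mul_le (a b c d : F) {m i : ℕ} (hi : i ≤ m) :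
    ((C a * X + C b) ^ i * (C c * X + C d) ^ (m - i)).natDegree ≤ m := by
  refine natDegree_mul_le.trans ?_
  have h1 : ((C a * X + C b) ^ i).natDegree ≤ i * 1 :=
    natDegree_pow_le_of_le i natDegree_linear_le
  have h2 : ((C c * X + C d) ^ (m - i)).natDegree ≤ (m - i) * 1 :=
    natDegree_pow_le_of_le (m - i) natDegree_linear_le
  omega

theorem coeffPoly_homographyMatrix (a b c d : F) (m : ℕ) (v : Fin (m + 1) → F) :
    coeffPoly ((homographyMatrix a b c d m).toLin' v) =
      ∑ i : Fin (m + 1), C (v i) * ((C a * X + C b) ^ (i : ℕ) * (C c * X + C d) ^ (m - (i : ℕ))) := by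
  set P := ∑ i : Fin (m + 1),
    C (v i) * ((C a * X + C b) ^ (i : ℕ) * (C c * X + C d) ^ (m - (i : ℕ)))
  have hP : P.natDegree ≤ m := by
    refine natDegree_sum_le_of_forall_le _ _ fun i _ => ?_
    exact (natDegree_C_mul_le _ _).trans
      (natDegree_linear_pow_mul_le a b c d (Nat.lt_succ_iff.1 i.2))
  rw [← coeffPoly_eq_of_natDegree_le hP]
  congr 1
  ext j
  simp only [Matrix.toLin'_apply, Matrix.mulVec, dotProduct, homographyMatrix, Matrix.of_apply, P,
    finsetSum_coeff, coeff_C_mul]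
  exact Finset.sum_congr rfl fun i _ => mul_comm _ _

/-- This is the homogeneity behind the transformation law: evaluation at x and at its image differ
by the factor (cx+d)^m. -/
theorem evalCoeff_homographyMatrix {K : Type*} [Field K] [Algebra F K] (a b c d : F) (m : ℕ)
    (v : Fin (m + 1) → F) (x : K) (hx : algebraMap F K c * x + algebraMap F K d ≠ 0) :
    evalCoeff x m ((homographyMatrix a b c d m).toLin' v) =
      (algebraMap F K c * x + algebraMap F K d) ^ m *
        evalCoeff ((algebraMap F K a * x + algebraMap F K b) /
          (algebraMap F K c * x + algebraMap F K d)) m v := by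
  rw [evalCoeff_apply _ _ v, Finset.mul_sum]
  change aeval x (coeffPoly _) = _
  rw [coeffPoly_homographyMatrix, map_sum]
  refine Finset.sum_congr rfl fun i _ => ?_
  have hi : (i : ℕ) ≤ m := Nat.lt_succ_iff.1 i.2
  simp only [map_mul, aeval_C, map_pow, map_add, aeval_X]
  set y := algebraMap F K c * x + algebraMap F K d
  have h1 : y ^ m = y ^ (m - (i : ℕ)) * y ^ (i : ℕ) := by rw [← pow_add, Nat.sub_add_cancel hi]
  rw [h1, div_pow]
  field_simp

/-- Substitution reverses products, so the matrix applied first is the left factor of the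
hypothesis. The identity is checked by evaluating at the points of the infinite field F. -/
theorem homographyMatrix_toLin'_comp [Infinite F] {a b c d a' b' c' d' : F}
    (h : !![a, b; c, d] * !![a', b'; c', d'] = 1) (m : ℕ) (v : Fin (m + 1) → F) :
    (homographyMatrix a' b' c' d' m).toLin' ((homographyMatrix a b c d m).toLin' v) = v := by
  have e00 : a * a' + b * c' = 1 := by simpa using congrFun (congrFun h 0) 0
  have e01 : a * b' + b * d' = 0 := by simpa using congrFun (congrFun h 0) 1
  have e10 : c * a' + d * c' = 0 := by simpa using congrFun (congrFun h 1) 0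
  have e11 : c * b' + d * d' = 1 := by simpa using congrFun (congrFun h 1) 1
  apply coeffPoly_injective
  have hL : C c' * X + C d' ≠ 0 := by
    intro h0
    have hc : c' = 0 := by simpa using congrArg (fun P => coeff P 1) h0
    have hd : d' = 0 := by simpa using congrArg (fun P => coeff P 0) h0
    rw [hc] at e00
    rw [hd] at e01 e11
    exact one_ne_zero (α := F) (by linear_combination -(c * b') * e00 - e11 + a' * c * e01)
  -- The extra factor c'X+d' vanishes at the pole of the second homography, so only the other points
  -- remain. There the two automorphy factors cancel.
  refine mul_left_cancel₀ hL (Polynomial.funext fun y => ?_)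
  rw [eval_mul, eval_mul]
  by_cases hy : c' * y + d' = 0
  · simp [hy]
  · congr 1
    set z := (a' * y + b') / (c' * y + d') with hz
    have hcz : c * z + d = (c' * y + d')⁻¹ := by
      refine eq_inv_of_mul_eq_one_left ?_
      rw [hz, add_mul, mul_assoc, div_mul_cancel₀ _ hy]
      linear_combination y * e10 + e11
    have haz : (a * z + b) / (c * z + d) = y := by
      rw [hcz, div_inv_eq_mul, hz, add_mul, mul_assoc, div_mul_cancel₀ _ hy]
      linear_combination y * e00 + e01
    have h1 := evalCoeff_homographyMatrix a' b' c' d' m ((homographyMatrix a b c d m).toLin' v) y hy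
    have h2 := evalCoeff_homographyMatrix a b c d m v z
      (by change c * z + d ≠ 0; rw [hcz]; exact inv_ne_zero hy)
    simp only [Algebra.algebraMap_self, RingHom.id_apply] at h1 h2
    rw [← hz, h2, haz, hcz, ← mul_assoc, ← mul_pow, mul_inv_cancel₀ hy, one_pow, one_mul] at h1
    rw [← coe_aeval_eq_eval]
    exact h1

/-- The product is the image of a polynomial over the valuation ring. -/
theorem norm_coeff_le_one_of_linear_pow_mul {F : Type*} [NormedField F] [IsUltrametricDist F]
    {a b c d : F} (ha : ‖a‖ ≤ 1) (hb : ‖b‖ ≤ 1) (hc : ‖c‖ ≤ 1) (hd : ‖d‖ ≤ 1) (k l j : ℕ) :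
    ‖((C a * X + C b) ^ k * (C c * X + C d) ^ l).coeff j‖ ≤ 1 := by
  let O : Subring F := (NormedField.valuation (K := F)).integer
  have hO : ∀ y : F, y ∈ O ↔ ‖y‖ ≤ 1 := fun y => Iff.rfl
  let P : O[X] := (C ⟨a, (hO a).2 ha⟩ * X + C ⟨b, (hO b).2 hb⟩) ^ k *
    (C ⟨c, (hO c).2 hc⟩ * X + C ⟨d, (hO d).2 hd⟩) ^ l
  have hP : P.map O.subtype = (C a * X + C b) ^ k * (C c * X + C d) ^ l := by
    simp [P, Polynomial.map_mul, Polynomial.map_pow, Polynomial.map_add]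
  rw [← hP, coeff_map]
  exact (hO _).1 (P.coeff j).2

theorem norm_homographyMatrix_toLin'_le {F : Type*} [NormedField F] [IsUltrametricDist F]
    {a b c d : F} (ha : ‖a‖ ≤ 1) (hb : ‖b‖ ≤ 1) (hc : ‖c‖ ≤ 1) (hd : ‖d‖ ≤ 1) (m : ℕ)
    {v : Fin (m + 1) → F} (hv : ‖v‖ ≤ 1) : ‖(homographyMatrix a b c d m).toLin' v‖ ≤ 1 := by
  rw [pi_norm_le_iff_of_nonneg zero_le_one] at hv ⊢
  intro j
  rw [Matrix.toLin'_apply, Matrix.mulVec, dotProduct]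
  refine IsUltrametricDist.norm_sum_le_of_forall_le_of_nonneg zero_le_one fun i _ => ?_
  rw [norm_mul]
  exact mul_le_one₀ (norm_coeff_le_one_of_linear_pow_mul ha hb hc hd _ _ _) (norm_nonneg _) (hv i)

end Homography

end Evaluation

/-! ### Normalized Haar measures -/

section BallHaar

/-- The Haar measure normalized so that the unit ball has measure `1`. -/
def ballHaar (E : Type*) [NormedField E] [ProperSpace E] [MeasurableSpace E] [BorelSpace E] :
    Measure E :=
  Measure.addHaarMeasure
    { carrier := Metric.closedBall (0 : E) 1
      isCompact' := isCompact_closedBall 0 1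
      interior_nonempty' :=
        ⟨0, mem_interior_iff_mem_nhds.2 (Metric.closedBall_mem_nhds 0 one_pos)⟩ }

instance (E : Type*) [NormedField E] [ProperSpace E] [MeasurableSpace E] [BorelSpace E] :
    (ballHaar E).IsAddHaarMeasure := by
  unfold ballHaar
  infer_instance

theorem ballHaar_closedBall (E : Type*) [NormedField E] [ProperSpace E] [MeasurableSpace E]
    [BorelSpace E] : ballHaar E (Metric.closedBall 0 1) = 1 :=
  Measure.addHaarMeasure_self (K₀ := ⟨⟨Metric.closedBall (0 : E) 1, isCompact_closedBall 0 1⟩,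
    ⟨0, mem_interior_iff_mem_nhds.2 (Metric.closedBall_mem_nhds 0 one_pos)⟩⟩)

/-- The probability measure on vectors with integral coordinates. -/
def coeffHaar (F : Type*) [NormedField F] [ProperSpace F] [MeasurableSpace F] [BorelSpace F]
    (ι : Type*) [Fintype ι] : Measure (ι → F) :=
  Measure.pi fun _ => (ballHaar F).restrict (Metric.closedBall 0 1)

theorem closedBall_pi_eq {F : Type*} [NormedField F] {ι : Type*} [Fintype ι] : Metric.closedBall (0 : ι → F) 1 =
    Set.univ.pi fun _ => Metric.closedBall (0 : F) 1 :=
  closedBall_pi _ zero_le_one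

variable {F : Type*} [NormedField F] [ProperSpace F] [MeasurableSpace F] [BorelSpace F]
  {ι : Type*} [Fintype ι]

theorem coeffHaar_eq_restrict : coeffHaar F ι =
    (Measure.pi fun _ : ι => ballHaar F).restrict (Metric.closedBall 0 1) := by
  rw [coeffHaar, closedBall_pi_eq, Measure.restrict_pi_pi]

theorem pi_ballHaar_closedBall :
    (Measure.pi fun _ : ι => ballHaar F) (Metric.closedBall 0 1) = 1 := by
  rw [closedBall_pi_eq, Measure.pi_pi]
  simp [ballHaar_closedBall]

instance : IsProbabilityMeasure ((ballHaar F).restrict (Metric.closedBall 0 1)) :=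
  ⟨by rw [Measure.restrict_apply_univ, ballHaar_closedBall]⟩

instance : IsProbabilityMeasure (coeffHaar F ι) := by
  unfold coeffHaar
  infer_instance

end BallHaar

/-! ### Moments and lattice volumes: homogeneity and continuity -/

section Moment

open scoped NNReal ENNReal

/-- The moment of order `e` of the absolute value at `x` of a random integral polynomial of degree
at most `m`. -/
def moment (F : Type*) {K : Type*} [NormedField F] [ProperSpace F] [MeasurableSpace F]
    [BorelSpace F] [NormedField K] [Algebra F K] (e m : ℕ) (x : K) : ℝ :=
  ∫ a, ‖evalCoeff x m a‖ ^ e ∂coeffHaar F (Fin (m + 1))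

/-- The volume of the lattice of values at `x` of integral polynomials of degree at most `m`. -/
def latticeVolume (F : Type*) {K : Type*} [NormedField F] [NormedField K] [ProperSpace K]
    [MeasurableSpace K] [BorelSpace K] [Algebra F K] (m : ℕ) (x : K) : ℝ :=
  (ballHaar K (evalCoeff x m '' Metric.closedBall (0 : Fin (m + 1) → F) 1)).toReal

/-- The matrix of the first powers of `x` in a basis. -/
def powerMatrix {F K : Type*} [Field F] [Field K] [Algebra F K] {ι : Type*} (b : Module.Basis ι F K) (m : ℕ) (x : K) : Matrix ι (Fin (m + 1)) F :=
  Matrix.of fun j i => b.repr (x ^ (i : ℕ)) j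

variable {F : Type*} [NontriviallyNormedField F]

theorem homographyMatrix_preimage_closedBall [IsUltrametricDist F] {a b c d a' b' c' d' : F}
    (ha : ‖a‖ ≤ 1) (hb : ‖b‖ ≤ 1) (hc : ‖c‖ ≤ 1) (hd : ‖d‖ ≤ 1)
    (ha' : ‖a'‖ ≤ 1) (hb' : ‖b'‖ ≤ 1) (hc' : ‖c'‖ ≤ 1) (hd' : ‖d'‖ ≤ 1)
    (h : !![a, b; c, d] * !![a', b'; c', d'] = 1) (m : ℕ) :
    (homographyMatrix a b c d m).toLin' ⁻¹' Metric.closedBall 0 1 = Metric.closedBall 0 1 := by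
  have := NontriviallyNormedField.infinite F
  ext v
  rw [Set.mem_preimage, mem_closedBall_zero_iff, mem_closedBall_zero_iff]
  refine ⟨fun hv => ?_, norm_homographyMatrix_toLin'_le ha hb hc hd m⟩
  rw [← homographyMatrix_toLin'_comp h m v]
  exact norm_homographyMatrix_toLin'_le ha' hb' hc' hd' m hv

theorem homographyMatrix_image_closedBall [IsUltrametricDist F] {a b c d a' b' c' d' : F}
    (ha : ‖a‖ ≤ 1) (hb : ‖b‖ ≤ 1) (hc : ‖c‖ ≤ 1) (hd : ‖d‖ ≤ 1)
    (ha' : ‖a'‖ ≤ 1) (hb' : ‖b'‖ ≤ 1) (hc' : ‖c'‖ ≤ 1) (hd' : ‖d'‖ ≤ 1)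
    (h : !![a', b'; c', d'] * !![a, b; c, d] = 1) (m : ℕ) :
    (homographyMatrix a b c d m).toLin' '' Metric.closedBall 0 1 = Metric.closedBall 0 1 := by
  have := NontriviallyNormedField.infinite F
  ext v
  constructor
  · rintro ⟨w, hw, rfl⟩
    rw [mem_closedBall_zero_iff] at hw ⊢
    exact norm_homographyMatrix_toLin'_le ha hb hc hd m hw
  · intro hv
    rw [mem_closedBall_zero_iff] at hv
    refine ⟨(homographyMatrix a' b' c' d' m).toLin' v, ?_, homographyMatrix_toLin'_comp h m v⟩
    rw [mem_closedBall_zero_iff]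
    exact norm_homographyMatrix_toLin'_le ha' hb' hc' hd' m hv

/-- An integral invertible homography permutes the integral coefficient vectors, so the lattice at x
is (cx+d)^m times the lattice at the image of x. -/
theorem latticeVolume_homography {F K : Type*} [NontriviallyNormedField F] [NormedField K]
    [NormedAlgebra F K] [ProperSpace K] [MeasurableSpace K] [BorelSpace K] (p : ℕ) [Fact p.Prime]
    [NormedAlgebra ℚ_[p] K] [FiniteDimensional ℚ_[p] K] [IsUltrametricDist F] {a b c d a' b' c' d' : F}
    (ha : ‖a‖ ≤ 1) (hb : ‖b‖ ≤ 1) (hc : ‖c‖ ≤ 1) (hd : ‖d‖ ≤ 1)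
    (ha' : ‖a'‖ ≤ 1) (hb' : ‖b'‖ ≤ 1) (hc' : ‖c'‖ ≤ 1) (hd' : ‖d'‖ ≤ 1)
    (h : !![a', b'; c', d'] * !![a, b; c, d] = 1) (m : ℕ) {x : K}
    (hx : algebraMap F K c * x + algebraMap F K d ≠ 0) :
    ‖algebraMap F K c * x + algebraMap F K d‖ ^ (m * Module.finrank ℚ_[p] K) *
      latticeVolume F m ((algebraMap F K a * x + algebraMap F K b) /
        (algebraMap F K c * x + algebraMap F K d)) = latticeVolume F m x := by
  set y := algebraMap F K c * x + algebraMap F K d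
  set B := Metric.closedBall (0 : Fin (m + 1) → F) 1
  have h1 : evalCoeff x m '' B = (y ^ m * ·) ''
      (evalCoeff ((algebraMap F K a * x + algebraMap F K b) / y) m '' B) := by
    conv_lhs => rw [show B = Metric.closedBall 0 1 from rfl,
      ← homographyMatrix_image_closedBall ha hb hc hd ha' hb' hc' hd' h m]
    rw [Set.image_image, Set.image_image]
    exact Set.image_congr fun v _ => evalCoeff_homographyMatrix a b c d m v x hx
  rw [latticeVolume, latticeVolume, h1, measure_image_mul_left_eq (p := p) _ (pow_ne_zero m hx),
    ENNReal.toReal_mul]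
  simp [← pow_mul, B]

theorem evalCoeff_continuous {K : Type*} [NormedField K] [NormedAlgebra F K]
    (x : K) (m : ℕ) : Continuous (evalCoeff x m : (Fin (m + 1) → F) → K) :=
  LinearMap.continuous_on_pi _

theorem isCompact_evalCoeff_image {K : Type*} [NormedField K] [NormedAlgebra F K] [ProperSpace F]
    (x : K) (m : ℕ) : IsCompact (evalCoeff x m '' Metric.closedBall (0 : Fin (m + 1) → F) 1) :=
  (isCompact_closedBall _ _).image (evalCoeff_continuous x m)

theorem integrable_coeffHaar_of_continuous [ProperSpace F] [MeasurableSpace F] [BorelSpace F]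
    {ι : Type*} [Fintype ι] {f : (ι → F) → ℝ} (hf : Continuous f) :
    Integrable f (coeffHaar F ι) := by
  have : SecondCountableTopology F := secondCountable_of_proper
  rw [coeffHaar_eq_restrict]
  exact hf.continuousOn.integrableOn_compact (isCompact_closedBall _ _)

theorem continuous_moment {K : Type*} [NormedField K] [NormedAlgebra F K] [ProperSpace F]
    [MeasurableSpace F] [BorelSpace F] [ProperSpace K] (e m : ℕ) :
    Continuous (moment F e m : K → ℝ) := by
  have : SecondCountableTopology F := secondCountable_of_proper
  unfold moment
  simp_rw [coeffHaar_eq_restrict]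
  refine continuous_parametric_integral_of_continuous ?_ (isCompact_closedBall _ _)
  simp only [Function.uncurry_def, evalCoeff_apply]
  have : Continuous (algebraMap F K) := continuous_algebraMap F K
  fun_prop

/-- All values lie in the proper subspace F[x]. Thus the vanishing case of the density is built into
the volume. -/
theorem latticeVolume_eq_zero {K : Type*} [NormedField K] [NormedAlgebra F K] [ProperSpace F]
    [ProperSpace K] [MeasurableSpace K] [BorelSpace K] (m : ℕ) {x : K}
    (hx : Algebra.adjoin F {x} ≠ ⊤) : latticeVolume F m x = 0 := by
  rw [latticeVolume, measure_eq_zero_of_subset_submodule (F := F) (ballHaar K)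
    (W := Subalgebra.toSubmodule (Algebra.adjoin F {x})) (by simpa using hx)
    (isCompact_evalCoeff_image x m).measurableSet, ENNReal.toReal_zero]
  rintro _ ⟨a, -, rfl⟩
  exact aeval_mem_adjoin_singleton F x

variable [ProperSpace F] [MeasurableSpace F] [BorelSpace F]

theorem map_homographyMatrix_coeffHaar (p : ℕ) [Fact p.Prime] [NormedAlgebra ℚ_[p] F]
    [FiniteDimensional ℚ_[p] F] [IsUltrametricDist F] {a b c d a' b' c' d' : F}
    (ha : ‖a‖ ≤ 1) (hb : ‖b‖ ≤ 1) (hc : ‖c‖ ≤ 1) (hd : ‖d‖ ≤ 1)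
    (ha' : ‖a'‖ ≤ 1) (hb' : ‖b'‖ ≤ 1) (hc' : ‖c'‖ ≤ 1) (hd' : ‖d'‖ ≤ 1)
    (h : !![a, b; c, d] * !![a', b'; c', d'] = 1) (m : ℕ) :
    (coeffHaar F (Fin (m + 1))).map (homographyMatrix a b c d m).toLin' =
      coeffHaar F (Fin (m + 1)) := by
  have : SecondCountableTopology F := secondCountable_of_proper
  have := NontriviallyNormedField.infinite F
  set T := homographyMatrix a b c d m
  have hT : Measurable (Matrix.toLin' T) := measurable_toLin' T
  have hpre : Matrix.toLin' T ⁻¹' Metric.closedBall 0 1 = Metric.closedBall 0 1 :=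
    homographyMatrix_preimage_closedBall ha hb hc hd ha' hb' hc' hd' h m
  have hdet : T.det ≠ 0 := by
    have h1 : homographyMatrix a' b' c' d' m * T = 1 := by
      apply (Matrix.toLin' (R := F)).injective
      rw [Matrix.toLin'_mul, Matrix.toLin'_one]
      exact LinearMap.ext fun v => homographyMatrix_toLin'_comp h m v
    intro h0
    have h2 := congrArg Matrix.det h1
    rw [Matrix.det_mul, h0, mul_zero, Matrix.det_one] at h2
    exact zero_ne_one h2
  have hmap := map_matrix_pi_haar (p := p) (ballHaar F) hdet
  set k : ℝ≥0 := (‖T.det‖₊ ^ Module.finrank ℚ_[p] F)⁻¹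
  -- The scaling factor is read off on the unit ball, which is its own preimage; the determinant
  -- need not be computed.
  have hk : k = 1 := by
    have h1 := congrArg (fun ν : Measure (Fin (m + 1) → F) => ν (Metric.closedBall 0 1)) hmap
    simp only [Measure.smul_apply] at h1
    rw [Measure.map_apply hT measurableSet_closedBall, hpre, pi_ballHaar_closedBall,
      ENNReal.smul_def, smul_eq_mul, mul_one] at h1
    exact_mod_cast h1.symm
  rw [coeffHaar_eq_restrict]
  conv_lhs => rw [← hpre]
  rw [← Measure.restrict_map hT measurableSet_closedBall, hmap, hk, one_smul]

variable {K : Type*} [NormedField K] [NormedAlgebra F K]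

theorem moment_homography (p : ℕ) [Fact p.Prime] [NormedAlgebra ℚ_[p] F]
    [FiniteDimensional ℚ_[p] F] [IsUltrametricDist F] {a b c d a' b' c' d' : F}
    (ha : ‖a‖ ≤ 1) (hb : ‖b‖ ≤ 1) (hc : ‖c‖ ≤ 1) (hd : ‖d‖ ≤ 1)
    (ha' : ‖a'‖ ≤ 1) (hb' : ‖b'‖ ≤ 1) (hc' : ‖c'‖ ≤ 1) (hd' : ‖d'‖ ≤ 1)
    (h : !![a, b; c, d] * !![a', b'; c', d'] = 1) (e m : ℕ) {x : K}
    (hx : algebraMap F K c * x + algebraMap F K d ≠ 0) :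
    ‖algebraMap F K c * x + algebraMap F K d‖ ^ (m * e) *
      moment F e m ((algebraMap F K a * x + algebraMap F K b) /
        (algebraMap F K c * x + algebraMap F K d)) = moment F e m x := by
  have : SecondCountableTopology F := secondCountable_of_proper
  conv_rhs => rw [moment, ← map_homographyMatrix_coeffHaar p ha hb hc hd ha' hb' hc' hd' h m]
  have hcont : Continuous fun v : Fin (m + 1) → F => ‖evalCoeff x m v‖ ^ e :=
    (evalCoeff_continuous x m).norm.pow e
  rw [integral_map (measurable_toLin' _).aemeasurable hcont.aestronglyMeasurable, moment, ← integral_const_mul]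
  refine integral_congr_ae (Filter.Eventually.of_forall fun v => ?_)
  simp only
  rw [evalCoeff_homographyMatrix a b c d m v x hx, norm_mul, norm_pow, mul_pow, ← pow_mul]

variable [ProperSpace K] [MeasurableSpace K] [BorelSpace K]

variable [FiniteDimensional F K]

/-- In coordinates the lattice is the image of the unit ball under the matrix of powers of x. The
constant k only compares two Haar measures on K; its value is irrelevant to continuity. -/
theorem exists_latticeVolume_eq (F K : Type*) [NontriviallyNormedField F] [ProperSpace F]
    [MeasurableSpace F] [BorelSpace F] [NormedField K] [NormedAlgebra F K] [ProperSpace K]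
    [MeasurableSpace K] [BorelSpace K] [FiniteDimensional F K] (p : ℕ) [Fact p.Prime] [NormedAlgebra ℚ_[p] F]
    [FiniteDimensional ℚ_[p] F] {m : ℕ} (hm : m + 1 = Module.finrank F K) :
    ∃ (k : ℝ) (b : Module.Basis (Fin (m + 1)) F K), ∀ x : K,
      latticeVolume F m x = k * ‖(powerMatrix b m x).det‖ ^ Module.finrank ℚ_[p] F := by
  have : SecondCountableTopology F := secondCountable_of_proper
  let b : Module.Basis (Fin (m + 1)) F K := Module.finBasisOfFinrankEq F K hm.symm
  let e : (Fin (m + 1) → F) ≃L[F] K := b.equivFun.symm.toContinuousLinearEquiv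
  let ν : Measure (Fin (m + 1) → F) := Measure.pi fun _ => ballHaar F
  have hν : (ν.map e).IsAddHaarMeasure := e.isAddHaarMeasure_map ν
  have he : ∀ x : K, ∀ v, evalCoeff x m v = e ((powerMatrix b m x).toLin' v) := by
    intro x v
    change _ = b.equivFun.symm _
    rw [LinearEquiv.eq_symm_apply, evalCoeff_apply]
    simp_rw [← Algebra.smul_def]
    rw [map_sum]
    ext j
    simp only [map_smul, Finset.sum_apply, Pi.smul_apply, Module.Basis.equivFun_apply, smul_eq_mul,
      Matrix.toLin'_apply, Matrix.mulVec, dotProduct, powerMatrix, Matrix.of_apply]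
    exact Finset.sum_congr rfl fun i _ => mul_comm _ _
  have hμ : ballHaar K = (Measure.addHaarScalarFactor (ballHaar K) (ν.map e)) • ν.map e :=
    Measure.isAddLeftInvariant_eq_smul _ _
  set k := Measure.addHaarScalarFactor (ballHaar K) (ν.map e)
  have hN : Module.finrank ℚ_[p] F ≠ 0 := Module.finrank_pos.ne'
  refine ⟨k, b, fun x => ?_⟩
  set M := powerMatrix b m x with hM
  have himg : evalCoeff x m '' Metric.closedBall (0 : Fin (m + 1) → F) 1 =
      e '' (M.toLin' '' Metric.closedBall 0 1) := by
    rw [Set.image_image]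
    exact Set.image_congr fun v _ => he x v
  -- A singular matrix has image in a proper subspace, so both sides vanish; the exponent on the
  -- right is positive.
  by_cases hdet : M.det = 0
  · rw [hdet, norm_zero, zero_pow hN, mul_zero]
    rw [latticeVolume, himg, hμ, Measure.smul_apply]
    have hc : IsCompact (M.toLin' '' Metric.closedBall 0 1) :=
      (isCompact_closedBall _ _).image (LinearMap.continuous_on_pi _)
    have h0 : (ν.map e) (e '' (M.toLin' '' Metric.closedBall 0 1)) = 0 := by
      refine measure_eq_zero_of_subset_submodule (F := F) (ν.map e)
        (W := LinearMap.range (e.toLinearMap ∘ₗ M.toLin')) ?_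
        (hc.image e.continuous).measurableSet ?_
      · intro htop
        have hs : Function.Surjective M.mulVec := by
          intro w
          obtain ⟨v, hv⟩ := LinearMap.range_eq_top.1 htop (e w)
          exact ⟨v, e.injective hv⟩
        have hu := (Matrix.isUnit_iff_isUnit_det M).1 (Matrix.mulVec_surjective_iff_isUnit.1 hs)
        rw [hdet] at hu
        exact not_isUnit_zero hu
      · rintro _ ⟨_, ⟨v, -, rfl⟩, rfl⟩
        exact ⟨v, rfl⟩
    rw [h0]
    simp
  · have hpre : ν (M.toLin' '' Metric.closedBall 0 1) =
        (‖M.det‖₊ ^ Module.finrank ℚ_[p] F : ℝ≥0) := by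
      have hinj : Function.Injective M.toLin' := Matrix.mulVec_injective_iff_isUnit.2
        ((Matrix.isUnit_iff_isUnit_det M).2 (isUnit_iff_ne_zero.2 hdet))
      have hc : IsCompact (M.toLin' '' Metric.closedBall 0 1) :=
        (isCompact_closedBall _ _).image (LinearMap.continuous_on_pi _)
      have hk0 : ‖M.det‖₊ ^ Module.finrank ℚ_[p] F ≠ 0 := pow_ne_zero _ (nnnorm_ne_zero_iff.2 hdet)
      have h1 := congrArg (fun ν' : Measure (Fin (m + 1) → F) =>
        ν' (M.toLin' '' Metric.closedBall 0 1)) (map_matrix_pi_haar (p := p) (ballHaar F) hdet)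
      simp only [Measure.smul_apply] at h1
      rw [Measure.map_apply (measurable_toLin' M) hc.measurableSet, Set.preimage_image_eq _ hinj,
        pi_ballHaar_closedBall, ENNReal.smul_def, smul_eq_mul] at h1
      rw [← one_mul (ν _), ← ENNReal.coe_one, ← mul_inv_cancel₀ hk0, ENNReal.coe_mul, mul_assoc,
        ← h1, mul_one]
    have h1 : (ν.map e) (e '' (M.toLin' '' Metric.closedBall 0 1)) =
        ν (M.toLin' '' Metric.closedBall 0 1) := by
      change (ν.map e.toHomeomorph.toMeasurableEquiv) _ = _
      rw [MeasurableEquiv.map_apply]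
      congr 1
      exact Set.preimage_image_eq _ e.injective
    rw [latticeVolume, himg, hμ, Measure.smul_apply, h1, hpre]
    simp [ENNReal.smul_def]

theorem continuous_latticeVolume (p : ℕ) [Fact p.Prime] [NormedAlgebra ℚ_[p] F]
    [FiniteDimensional ℚ_[p] F] {m : ℕ} (hm : m + 1 = Module.finrank F K) :
    Continuous (latticeVolume F m : K → ℝ) := by
  obtain ⟨k, b, h⟩ := exists_latticeVolume_eq F K p hm
  rw [show (latticeVolume F m : K → ℝ) = _ from funext h]
  refine continuous_const.mul (Continuous.pow (Continuous.norm ?_) _)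
  refine Continuous.matrix_det (continuous_matrix fun i j => ?_)
  simp only [powerMatrix, Matrix.of_apply]
  have h1 : Continuous (b.coord i) := LinearMap.continuous_of_finiteDimensional _
  exact h1.comp (continuous_pow _)

end Moment

/-! ### Effect of adding a constant to a random value -/

section Translation

open scoped NNReal ENNReal

variable {F : Type*} [NontriviallyNormedField F] [ProperSpace F]
  [MeasurableSpace F] [BorelSpace F]

theorem measurePreserving_add_right_coeffHaar [IsUltrametricDist F] {ι : Type*} [Fintype ι] {a₀ : ι → F}
    (ha₀ : ‖a₀‖ ≤ 1) : MeasurePreserving (MeasurableEquiv.addRight a₀) (coeffHaar F ι)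
      (coeffHaar F ι) := by
  have : SecondCountableTopology F := secondCountable_of_proper
  have h1 : MeasurePreserving (MeasurableEquiv.addRight a₀) (Measure.pi fun _ : ι => ballHaar F)
      (Measure.pi fun _ : ι => ballHaar F) := measurePreserving_add_right _ a₀
  have h2 : MeasurableEquiv.addRight a₀ ⁻¹' Metric.closedBall (0 : ι → F) 1 =
      Metric.closedBall 0 1 := by
    ext a
    change a + a₀ ∈ Metric.closedBall 0 1 ↔ _
    rw [mem_closedBall_zero_iff, mem_closedBall_zero_iff]
    constructor
    · intro h
      have h3 := (IsUltrametricDist.norm_add_le_max (a + a₀) (-a₀)).trans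
        (max_le h ((norm_neg a₀).trans_le ha₀))
      rwa [add_neg_cancel_right] at h3
    · intro h
      exact (IsUltrametricDist.norm_add_le_max a a₀).trans (max_le h ha₀)
  have h3 := h1.restrict_preimage (s := Metric.closedBall (0 : ι → F) 1) measurableSet_closedBall
  rwa [h2, ← coeffHaar_eq_restrict] at h3

variable {K : Type*} [NormedField K] [NormedAlgebra F K]

/-- A shift by a lattice element is absorbed by an integral translation of the coefficients. -/
theorem integral_evalCoeff_add_eq [IsUltrametricDist F] {m : ℕ} {x s : K}
    (hs : s ∈ evalCoeff x m '' Metric.closedBall (0 : Fin (m + 1) → F) 1) (f : K → ℝ) :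
    ∫ a, f (evalCoeff x m a + s) ∂coeffHaar F (Fin (m + 1)) =
      ∫ a, f (evalCoeff x m a) ∂coeffHaar F (Fin (m + 1)) := by
  obtain ⟨a₀, ha₀, rfl⟩ := hs
  have h1 := (measurePreserving_add_right_coeffHaar (mem_closedBall_zero_iff.1 ha₀)).integral_comp'
    (fun a => f (evalCoeff x m a))
  rw [← h1]
  refine integral_congr_ae (Filter.Eventually.of_forall fun a => ?_)
  change _ = f (evalCoeff x m (a + a₀))
  rw [map_add]

theorem ae_norm_le_one_coeffHaar {ι : Type*} [Fintype ι] : ∀ᵐ a ∂coeffHaar F ι, ‖a‖ ≤ 1 := by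
  rw [coeffHaar_eq_restrict]
  filter_upwards [ae_restrict_mem measurableSet_closedBall] with a ha
  exact mem_closedBall_zero_iff.1 ha

theorem integrable_norm_evalCoeff_add_pow (x s : K) (e m : ℕ) :
    Integrable (fun a => ‖evalCoeff x m a + s‖ ^ e) (coeffHaar F (Fin (m + 1))) :=
  integrable_coeffHaar_of_continuous
    (((evalCoeff_continuous x m).add continuous_const).norm.pow e)

theorem integral_lt_integral_of_le_of_measure_ne_zero {α : Type*} [MeasurableSpace α]
    {μ : Measure α} {f g : α → ℝ} (hf : Integrable f μ) (hg : Integrable g μ) (hfg : f ≤ᵐ[μ] g)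
    (h : μ {a | f a ≠ g a} ≠ 0) : ∫ a, f a ∂μ < ∫ a, g a ∂μ := by
  rw [← sub_pos, ← integral_sub hg hf]
  refine (integral_pos_iff_support_of_nonneg_ae ?_ (hg.sub hf)).2 (pos_iff_ne_zero.2 ?_)
  · filter_upwards [hfg] with a ha
    exact sub_nonneg.2 ha
  · convert h using 3
    ext a
    simp [sub_ne_zero, eq_comm]

/-- By compactness, choose the element of least norm in the class of s modulo the lattice. The
ultrametric inequality is an equality when the two norms differ; when they agree, minimality
prevents cancellation. -/
theorem exists_shift_norm_ge {F K : Type*} [NontriviallyNormedField F] [IsUltrametricDist F]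
    [ProperSpace F] [NormedField K] [NormedAlgebra F K] [IsUltrametricDist K] (x s : K) (m : ℕ) : ∃ a₀ : Fin (m + 1) → F, ‖a₀‖ ≤ 1 ∧
    ∀ a : Fin (m + 1) → F, ‖a‖ ≤ 1 →
      ‖evalCoeff x m a + (evalCoeff x m a₀ + s)‖ =
        max ‖evalCoeff x m a‖ ‖evalCoeff x m a₀ + s‖ := by
  obtain ⟨a₀, ha₀, hmin⟩ := (isCompact_closedBall (0 : Fin (m + 1) → F) 1).exists_isMinOn
    ⟨0, by simp⟩ (((evalCoeff_continuous x m).add (continuous_const (y := s))).norm.continuousOn)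
  rw [mem_closedBall_zero_iff] at ha₀
  refine ⟨a₀, ha₀, fun a ha => ?_⟩
  by_cases h : ‖evalCoeff x m a‖ = ‖evalCoeff x m a₀ + s‖
  · refine le_antisymm (IsUltrametricDist.norm_add_le_max _ _) ?_
    rw [h, max_self, ← add_assoc, ← map_add]
    exact hmin (mem_closedBall_zero_iff.2
      ((IsUltrametricDist.norm_add_le_max a a₀).trans (max_le ha ha₀)))
  · exact IsUltrametricDist.norm_add_eq_max_of_norm_ne_norm h

variable [IsUltrametricDist K]

theorem moment_le_integral_add [IsUltrametricDist F] (e m : ℕ) (x s : K) :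
    moment F e m x ≤ ∫ a, ‖evalCoeff x m a + s‖ ^ e ∂coeffHaar F (Fin (m + 1)) := by
  obtain ⟨a₀, ha₀, h⟩ := exists_shift_norm_ge (F := F) x s m
  rw [← integral_evalCoeff_add_eq ⟨a₀, mem_closedBall_zero_iff.2 ha₀, rfl⟩ fun t => ‖t + s‖ ^ e]
  simp only [add_assoc]
  refine integral_mono_ae (integrable_coeffHaar_of_continuous
    ((evalCoeff_continuous x m).norm.pow e)) (integrable_norm_evalCoeff_add_pow x _ e m) ?_
  filter_upwards [ae_norm_le_one_coeffHaar] with a ha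
  rw [h a ha]
  exact pow_le_pow_left₀ (norm_nonneg _) (le_max_left _ _) e

theorem coeffHaar_ne_zero_of_mem_nhds {ι : Type*} [Fintype ι] {U : Set (ι → F)}
    (hU : U ∈ nhds 0) : coeffHaar F ι U ≠ 0 := by
  have : SecondCountableTopology F := secondCountable_of_proper
  have h1 : U ∩ Metric.closedBall 0 1 ∈ nhds (0 : ι → F) :=
    Filter.inter_mem hU (Metric.closedBall_mem_nhds 0 one_pos)
  rw [coeffHaar_eq_restrict, Measure.restrict_apply' measurableSet_closedBall]
  exact (Measure.measure_pos_of_mem_nhds _ h1).ne'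

/-- A least representative of a nontrivial class is nonzero, hence dominates Q(x) strictly when the
coefficients of Q are small, an event of positive probability. -/
theorem moment_lt_integral_add [IsUltrametricDist F] {e : ℕ} (he : e ≠ 0) (m : ℕ) {x s : K}
    (hs : s ∉ evalCoeff x m '' Metric.closedBall (0 : Fin (m + 1) → F) 1) :
    moment F e m x < ∫ a, ‖evalCoeff x m a + s‖ ^ e ∂coeffHaar F (Fin (m + 1)) := by
  obtain ⟨a₀, ha₀, h⟩ := exists_shift_norm_ge (F := F) x s m
  rw [← integral_evalCoeff_add_eq ⟨a₀, mem_closedBall_zero_iff.2 ha₀, rfl⟩ fun t => ‖t + s‖ ^ e]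
  simp only [add_assoc]
  set s' := evalCoeff x m a₀ + s with hs'
  have hs'0 : 0 < ‖s'‖ := by
    rw [norm_pos_iff]
    intro h0
    refine hs ⟨-a₀, by simpa using ha₀, ?_⟩
    rw [map_neg, neg_eq_iff_add_eq_zero]
    exact h0
  refine integral_lt_integral_of_le_of_measure_ne_zero (integrable_coeffHaar_of_continuous
    ((evalCoeff_continuous x m).norm.pow e)) (integrable_norm_evalCoeff_add_pow x _ e m) ?_ ?_
  · filter_upwards [ae_norm_le_one_coeffHaar] with a ha
    rw [h a ha]
    exact pow_le_pow_left₀ (norm_nonneg _) (le_max_left _ _) e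
  · have hU : {a : Fin (m + 1) → F | ‖evalCoeff x m a‖ < ‖s'‖} ∩ Metric.closedBall 0 1 ∈
        nhds (0 : Fin (m + 1) → F) := by
      refine Filter.inter_mem ?_ (Metric.closedBall_mem_nhds 0 one_pos)
      refine (isOpen_lt (evalCoeff_continuous x m).norm continuous_const).mem_nhds ?_
      simpa using hs'0
    refine ne_of_gt (lt_of_lt_of_le (pos_iff_ne_zero.2 (coeffHaar_ne_zero_of_mem_nhds hU))
      (measure_mono ?_))
    rintro a ⟨ha1, ha2⟩
    rw [Set.mem_ofPred_eq, h a (mem_closedBall_zero_iff.1 ha2)]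
    refine ne_of_lt (pow_lt_pow_left₀ ?_ (norm_nonneg _) he)
    exact lt_max_of_lt_right ha1

end Translation

/-! ### Recursion on the degree by conditioning on the leading coefficient -/

section Recursion

theorem evalCoeff_succ {F K : Type*} [Field F] [Field K] [Algebra F K] (x : K) (m : ℕ) (a : Fin (m + 1 + 1) → F) :
    evalCoeff x (m + 1) a = evalCoeff x m (fun i => a ((Fin.last (m + 1)).succAbove i)) +
      algebraMap F K (a (Fin.last (m + 1))) * x ^ (m + 1) := by
  rw [evalCoeff_apply, evalCoeff_apply, Fin.sum_univ_castSucc]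
  simp

variable {F : Type*} [NontriviallyNormedField F] [ProperSpace F]
  [MeasurableSpace F] [BorelSpace F] {K : Type*} [NormedField K] [NormedAlgebra F K]

theorem integrable_prod_norm_evalCoeff_add (e m : ℕ) (x : K) :
    Integrable (fun z : F × (Fin (m + 1) → F) =>
        ‖evalCoeff x m z.2 + algebraMap F K z.1 * x ^ (m + 1)‖ ^ e)
      (((ballHaar F).restrict (Metric.closedBall 0 1)).prod (coeffHaar F (Fin (m + 1)))) := by
  have hp := measurePreserving_piFinSuccAbove (fun _ : Fin (m + 1 + 1) =>
    (ballHaar F).restrict (Metric.closedBall 0 1)) (Fin.last (m + 1))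
  have h1 : Integrable (fun a => ‖evalCoeff x (m + 1) a‖ ^ e) (coeffHaar F (Fin (m + 1 + 1))) :=
    integrable_coeffHaar_of_continuous ((evalCoeff_continuous x (m + 1)).norm.pow e)
  refine (hp.integrable_comp_emb (MeasurableEquiv.measurableEmbedding _)).1 ?_
  refine h1.congr (Filter.Eventually.of_forall fun a => ?_)
  simp only
  rw [evalCoeff_succ]
  rfl

theorem moment_succ (e m : ℕ) (x : K) :
    moment F e (m + 1) x = ∫ b, (∫ a, ‖evalCoeff x m a + algebraMap F K b * x ^ (m + 1)‖ ^ e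
      ∂coeffHaar F (Fin (m + 1))) ∂(ballHaar F).restrict (Metric.closedBall 0 1) := by
  have hp := measurePreserving_piFinSuccAbove (fun _ : Fin (m + 1 + 1) =>
    (ballHaar F).restrict (Metric.closedBall 0 1)) (Fin.last (m + 1))
  have h1 := hp.integral_comp' (fun z : F × (Fin (m + 1) → F) =>
        ‖evalCoeff x m z.2 + algebraMap F K z.1 * x ^ (m + 1)‖ ^ e)
  refine Eq.trans ?_ (h1.trans (integral_prod _ (integrable_prod_norm_evalCoeff_add e m x)))
  refine integral_congr_ae (Filter.Eventually.of_forall fun a => ?_)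
  simp only
  rw [evalCoeff_succ]
  rfl

theorem moment_le_moment_succ [IsUltrametricDist F] [IsUltrametricDist K] (e m : ℕ) (x : K) :
    moment F e m x ≤ moment F e (m + 1) x := by
  rw [moment_succ]
  have h1 : moment F e m x =
      ∫ _, moment F e m x ∂(ballHaar F).restrict (Metric.closedBall 0 1) := by simp
  rw [h1]
  exact integral_mono (integrable_const _)
    (integrable_prod_norm_evalCoeff_add e m x).integral_prod_left
    fun b => moment_le_integral_add e m x _

theorem moment_succ_eq_of_forall_mem [IsUltrametricDist F] (e m : ℕ) {x : K}
    (hx : ∀ b : F, ‖b‖ ≤ 1 → algebraMap F K b * x ^ (m + 1) ∈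
      evalCoeff x m '' Metric.closedBall (0 : Fin (m + 1) → F) 1) :
    moment F e (m + 1) x = moment F e m x := by
  rw [moment_succ]
  have h1 : moment F e m x =
      ∫ _, moment F e m x ∂(ballHaar F).restrict (Metric.closedBall 0 1) := by simp
  rw [h1]
  refine integral_congr_ae ?_
  filter_upwards [ae_restrict_mem measurableSet_closedBall] with b hb
  exact integral_evalCoeff_add_eq (hx b (mem_closedBall_zero_iff.1 hb)) fun t => ‖t‖ ^ e

/-- By independence of the powers of x, a nonzero leading term never belongs to the lattice of lower
degree values, so the conditional moment increases strictly for almost every leading coefficient. -/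
theorem moment_lt_moment_succ [IsUltrametricDist F] [IsUltrametricDist K] {e : ℕ} (he : e ≠ 0)
    (m : ℕ) {x : K} (hx : Function.Injective (evalCoeff x (m + 1) : (Fin (m + 1 + 1) → F) → K)) :
    moment F e m x < moment F e (m + 1) x := by
  rw [moment_succ]
  have h1 : moment F e m x =
      ∫ _, moment F e m x ∂(ballHaar F).restrict (Metric.closedBall 0 1) := by simp
  rw [h1]
  have hlt : ∀ b : F, b ≠ 0 → moment F e m x <
      ∫ a, ‖evalCoeff x m a + algebraMap F K b * x ^ (m + 1)‖ ^ e ∂coeffHaar F (Fin (m + 1)) := by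
    intro b hb
    refine moment_lt_integral_add he m ?_
    rintro ⟨a, -, ha⟩
    -- Moving the leading term across produces a polynomial vanishing at x with top coefficient -b.
    have h2 : evalCoeff x (m + 1) (Fin.snoc (α := fun _ => F) a (-b)) =
        evalCoeff x (m + 1) (0 : Fin (m + 1 + 1) → F) := by
      rw [evalCoeff_succ, map_zero]
      simp [ha]
    have h3 := congrFun (hx h2) (Fin.last (m + 1))
    simp only [Fin.snoc_last, Pi.zero_apply, neg_eq_zero] at h3
    exact hb h3
  refine integral_lt_integral_of_le_of_measure_ne_zero (integrable_const _)
    (integrable_prod_norm_evalCoeff_add e m x).integral_prod_left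
    (Filter.Eventually.of_forall fun b => moment_le_integral_add e m x _) ?_
  have h2 : ((ballHaar F).restrict (Metric.closedBall 0 1)) {0}ᶜ ≠ 0 := by
    rw [prob_compl_eq_one_sub (measurableSet_singleton 0)]
    simp
  refine ne_of_gt (lt_of_lt_of_le (pos_iff_ne_zero.2 h2) (measure_mono fun b hb => ?_))
  exact (hlt b hb).ne

end Recursion

/-! ### The lattice of values at an integral generator -/

section Lattice

variable {F : Type*} [NontriviallyNormedField F] [IsUltrametricDist F] {K : Type*} [NormedField K]
  [NormedAlgebra F K]

/-- The lattice of values at `x` of integral polynomials of degree at most `m`. -/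
def evalLattice (F : Type*) [NontriviallyNormedField F] [IsUltrametricDist F] {K : Type*}
    [NormedField K] [NormedAlgebra F K] (x : K) (m : ℕ) : AddSubgroup K where
  carrier := evalCoeff x m '' Metric.closedBall (0 : Fin (m + 1) → F) 1
  add_mem' := by
    rintro _ _ ⟨a, ha, rfl⟩ ⟨b, hb, rfl⟩
    rw [mem_closedBall_zero_iff] at ha hb
    exact ⟨a + b, mem_closedBall_zero_iff.2
      ((IsUltrametricDist.norm_add_le_max a b).trans (max_le ha hb)), map_add _ _ _⟩
  zero_mem' := ⟨0, by simp, map_zero _⟩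
  neg_mem' := by
    rintro _ ⟨a, ha, rfl⟩
    exact ⟨-a, by simpa using ha, map_neg _ _⟩

theorem algebraMap_mul_mem_evalLattice {x : K} {m : ℕ} {c : F} (hc : ‖c‖ ≤ 1) {y : K}
    (hy : y ∈ evalLattice F x m) : algebraMap F K c * y ∈ evalLattice F x m := by
  obtain ⟨a, ha, rfl⟩ := hy
  rw [mem_closedBall_zero_iff] at ha
  refine ⟨c • a, ?_, by rw [map_smul, Algebra.smul_def]⟩
  rw [mem_closedBall_zero_iff, norm_smul]
  exact mul_le_one₀ hc (norm_nonneg _) ha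

theorem norm_coeff_minpoly_le_one [CompleteSpace F] [FiniteDimensional F K] {x : K} (hx : ‖x‖ ≤ 1)
    (k : ℕ) : ‖(minpoly F x).coeff k‖ ≤ 1 := by
  rw [NormedAlgebra.norm_eq_spectralNorm F] at hx
  exact (spectralValue_le_one_iff (minpoly.monic (Algebra.IsIntegral.isIntegral x))).1 hx k

/-- The minimal polynomial is monic with integral coefficients, so high powers of x reduce to lower
ones with integral coefficients. -/
theorem pow_mem_evalLattice [CompleteSpace F] [FiniteDimensional F K] {x : K} (hx : ‖x‖ ≤ 1)
    {m : ℕ} (hm : (minpoly F x).natDegree ≤ m + 1) (k : ℕ) : x ^ k ∈ evalLattice F x m := by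
  induction k using Nat.strong_induction_on with
  | _ k ih =>
    rcases Nat.lt_or_ge k (m + 1) with hk | hk
    · refine ⟨Pi.single ⟨k, hk⟩ 1, ?_, ?_⟩
      · rw [mem_closedBall_zero_iff, pi_norm_le_iff_of_nonneg zero_le_one]
        intro i
        rcases eq_or_ne i ⟨k, hk⟩ with rfl | hi
        · simp
        · simp [hi]
      · rw [evalCoeff_apply, Finset.sum_eq_single ⟨k, hk⟩]
        · simp
        · intro i _ hi
          simp [hi]
        · simp
    · set P := minpoly F x
      set d := P.natDegree
      have hmonic : P.Monic := minpoly.monic (Algebra.IsIntegral.isIntegral x)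
      have h1 : x ^ d = -∑ i ∈ Finset.range d, algebraMap F K (P.coeff i) * x ^ i := by
        have h2 : aeval x P = 0 := minpoly.aeval F x
        rw [hmonic.as_sum] at h2
        simp only [map_add, map_pow, aeval_X, map_sum, map_mul, aeval_C] at h2
        exact eq_neg_of_add_eq_zero_left h2
      have h2 : x ^ k = -∑ i ∈ Finset.range d, algebraMap F K (P.coeff i) * x ^ (i + (k - d)) := by
        conv_lhs => rw [← Nat.add_sub_cancel' (hm.trans hk), pow_add, h1]
        rw [neg_mul, Finset.sum_mul]
        simp only [mul_assoc, pow_add]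
      rw [h2]
      refine neg_mem (sum_mem fun i hi => algebraMap_mul_mem_evalLattice
        (norm_coeff_minpoly_le_one hx i) (ih _ ?_))
      have := Finset.mem_range.1 hi
      omega

theorem natDegree_minpoly_of_adjoin_eq_top {F K : Type*} [Field F] [Field K] [Algebra F K]
    [FiniteDimensional F K] {x : K} (hx : Algebra.adjoin F {x} = ⊤) :
    (minpoly F x).natDegree = Module.finrank F K := by
  rw [← Field.primitive_element_iff_minpoly_natDegree_eq]
  exact IntermediateField.adjoin_eq_top_of_algebra F {x} hx

theorem evalCoeff_injective {F K : Type*} [Field F] [Field K] [Algebra F K]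
    [FiniteDimensional F K] {x : K} (hx : Algebra.adjoin F {x} = ⊤) {m : ℕ}
    (hm : m < Module.finrank F K) :
    Function.Injective (evalCoeff x m : (Fin (m + 1) → F) → K) := by
  rw [← LinearMap.ker_eq_bot, LinearMap.ker_eq_bot']
  intro a ha
  apply coeffPoly_injective
  have h0 : coeffPoly (0 : Fin (m + 1) → F) = 0 := by simp [coeffPoly]
  rw [h0]
  by_contra hne
  have h1 := natDegree_le_natDegree (minpoly.degree_le_of_ne_zero F x hne ha)
  rw [natDegree_minpoly_of_adjoin_eq_top hx] at h1
  have h2 : (coeffPoly a).natDegree ≤ m :=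
    natDegree_sum_le_of_forall_le _ _ fun i _ =>
      (natDegree_C_mul_X_pow_le _ _).trans (Nat.lt_succ_iff.1 i.2)
  omega

variable [ProperSpace F] [MeasurableSpace F] [BorelSpace F]

/-- The new leading term already lies in the lattice, so translation invariance applies. -/
theorem moment_eq_of_finrank_le [FiniteDimensional F K] (e : ℕ) {x : K}
    (hx : Algebra.adjoin F {x} = ⊤) (hx1 : ‖x‖ ≤ 1) {m : ℕ} (hm : Module.finrank F K ≤ m + 1) :
    moment F e (m + 1) x = moment F e m x := by
  refine moment_succ_eq_of_forall_mem e m fun b hb => ?_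
  refine algebraMap_mul_mem_evalLattice hb (pow_mem_evalLattice hx1 ?_ _)
  rwa [natDegree_minpoly_of_adjoin_eq_top hx]

theorem moment_eq_moment_of_finrank_le [FiniteDimensional F K] (e : ℕ) {x : K}
    (hx : Algebra.adjoin F {x} = ⊤) (hx1 : ‖x‖ ≤ 1) {m k : ℕ} (hm : Module.finrank F K ≤ m + 1)
    (hk : m ≤ k) : moment F e k x = moment F e m x := by
  induction k, hk using Nat.le_induction with
  | base => rfl
  | succ k hk ih => rw [moment_eq_of_finrank_le e hx hx1 (by omega), ih]

/-- In degree less than r, evaluation is a linear isomorphism. It carries the uniform measure on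
coefficients to the uniform measure on the lattice, so the moment is an average over the lattice. -/
theorem latticeVolume_mul_moment [FiniteDimensional F K] [ProperSpace K] [MeasurableSpace K]
    [BorelSpace K] (e : ℕ) {x : K} (hx : Algebra.adjoin F {x} = ⊤) {m : ℕ}
    (hm : m + 1 = Module.finrank F K) :
    latticeVolume F m x * moment F e m x =
      ∫ t in (evalCoeff x m '' Metric.closedBall (0 : Fin (m + 1) → F) 1), ‖t‖ ^ e ∂ballHaar K := by
  have : SecondCountableTopology F := secondCountable_of_proper
  have hinj := evalCoeff_injective hx (m := m) (by omega)
  let φ : (Fin (m + 1) → F) ≃L[F] K := (LinearEquiv.ofInjectiveOfFinrankEq (evalCoeff x m) hinj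
    (by simp [hm])).toContinuousLinearEquiv
  have hφ : ∀ a, φ a = evalCoeff x m a := fun a => rfl
  set B := Metric.closedBall (0 : Fin (m + 1) → F) 1
  set ν : Measure (Fin (m + 1) → F) := Measure.pi fun _ => ballHaar F
  have hν : (ν.map φ).IsAddHaarMeasure := φ.isAddHaarMeasure_map ν
  have hμ : ν.map φ = (Measure.addHaarScalarFactor (ν.map φ) (ballHaar K)) • ballHaar K :=
    Measure.isAddLeftInvariant_eq_smul _ _
  set k := Measure.addHaarScalarFactor (ν.map φ) (ballHaar K)
  set L : Set K := evalCoeff x m '' B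
  have hL : MeasurableSet L := (isCompact_evalCoeff_image x m).measurableSet
  have hpre : φ ⁻¹' L = B := Set.preimage_image_eq _ φ.injective
  have hmap : (coeffHaar F (Fin (m + 1))).map φ = k • (ballHaar K).restrict L := by
    rw [coeffHaar_eq_restrict, ← Measure.restrict_smul, ← hμ,
      Measure.restrict_map φ.continuous.measurable hL, hpre]
  -- The pushed forward measure gives the lattice mass one, which fixes the proportionality constant
  -- k.
  have hk : (k : ℝ) * latticeVolume F m x = 1 := by
    have h1 := congrArg (fun ρ : Measure K => (ρ L).toReal) hμ
    rw [Measure.map_apply φ.continuous.measurable hL, hpre, pi_ballHaar_closedBall] at h1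
    rw [latticeVolume]
    rw [Measure.smul_apply, ENNReal.smul_def, smul_eq_mul, ENNReal.toReal_mul, ENNReal.toReal_one,
      ENNReal.coe_toReal] at h1
    exact h1.symm
  have hcont : Continuous fun t : K => ‖t‖ ^ e := continuous_norm.pow e
  have hmom : moment F e m x = k * ∫ t in L, ‖t‖ ^ e ∂ballHaar K := by
    have h1 : moment F e m x = ∫ t, ‖t‖ ^ e ∂(coeffHaar F (Fin (m + 1))).map φ := by
      rw [integral_map φ.continuous.measurable.aemeasurable hcont.aestronglyMeasurable]
      rfl
    rw [h1, hmap, integral_smul_nnreal_measure]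
    rfl
  rw [hmom, ← mul_assoc, mul_comm (latticeVolume F m x), hk, one_mul]

end Lattice

/-! ### The moment in degree zero -/

section Uniformizer

theorem moment_zero_eq {F K : Type*} [NontriviallyNormedField F] [ProperSpace F] [MeasurableSpace F]
    [BorelSpace F] [NormedField K] [NormedAlgebra F K] (e : ℕ) (x : K) :
    moment F e 0 x = ∫ a in Metric.closedBall (0 : F) 1, ‖a‖ ^ e ∂ballHaar F := by
  have h1 := measurePreserving_eval (fun _ : Fin 1 =>
    (ballHaar F).restrict (Metric.closedBall 0 1)) 0
  have hcont : Continuous fun t : F => ‖t‖ ^ e := continuous_norm.pow e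
  rw [← h1.map_eq, integral_map h1.measurable.aemeasurable hcont.aestronglyMeasurable, moment]
  refine integral_congr_ae (Filter.Eventually.of_forall fun a => ?_)
  simp [evalCoeff_apply, norm_algebraMap']

variable {F : Type*} [NontriviallyNormedField F] [IsUltrametricDist F] [ProperSpace F]

variable (F) in
-- The open unit ball is closed in an ultrametric space, hence compact, so the norm attains its
-- maximum there; the maximum is positive since the norm is nontrivial.
theorem exists_uniformizer : ∃ π : F, π ≠ 0 ∧ ‖π‖ < 1 ∧ ∀ a : F, ‖a‖ < 1 → ‖a‖ ≤ ‖π‖ := by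
  have hc : IsCompact (Metric.ball (0 : F) 1) :=
    (isCompact_closedBall (0 : F) 1).of_isClosed_subset
      (IsUltrametricDist.isClosed_ball 0 1) Metric.ball_subset_closedBall
  obtain ⟨π, hπ, hmax⟩ := hc.exists_isMaxOn ⟨0, by simp⟩ continuous_norm.continuousOn
  have hmax' : ∀ a : F, ‖a‖ < 1 → ‖a‖ ≤ ‖π‖ := fun a ha => hmax (mem_ball_zero_iff.2 ha)
  obtain ⟨y, hy0, hy1⟩ := NormedField.exists_norm_lt_one F
  exact ⟨π, norm_pos_iff.1 (hy0.trans_le (hmax' y hy1)), mem_ball_zero_iff.1 hπ, hmax'⟩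

variable [MeasurableSpace F] [BorelSpace F]

/-- The open ball is π times the closed ball, and the integrand is 1 on the sphere. With I the
integral this gives I = (1 - c) + c^(r+1) I. -/
theorem integral_norm_pow_eq (p : ℕ) [Fact p.Prime] [NormedAlgebra ℚ_[p] F]
    [FiniteDimensional ℚ_[p] F] (r : ℕ) {c : ℝ}
    (hc : c = (ballHaar F (Metric.ball 0 1)).toReal) :
    c < 1 ∧
    (∫ a in Metric.closedBall (0 : F) 1, ‖a‖ ^ (Module.finrank ℚ_[p] F * r) ∂ballHaar F) *
      (1 - c ^ (r + 1)) = 1 - c := by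
  obtain ⟨π, hπ0, hπ1, hπ⟩ := exists_uniformizer F
  set N := Module.finrank ℚ_[p] F
  have hN : N ≠ 0 := Module.finrank_pos.ne'
  set B := Metric.closedBall (0 : F) 1
  have himg : (π * ·) '' B = Metric.ball (0 : F) 1 := by
    ext a
    constructor
    · rintro ⟨b, hb, rfl⟩
      rw [mem_closedBall_zero_iff] at hb
      rw [mem_ball_zero_iff, norm_mul]
      exact (mul_le_of_le_one_right (norm_nonneg _) hb).trans_lt hπ1
    · intro ha
      refine ⟨π⁻¹ * a, ?_, mul_inv_cancel_left₀ hπ0 a⟩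
      rw [mem_closedBall_zero_iff, norm_mul, norm_inv]
      exact (inv_mul_le_one₀ (norm_pos_iff.2 hπ0)).2 (hπ a (mem_ball_zero_iff.1 ha))
  have hball : ballHaar F (Metric.ball 0 1) = (‖π‖₊ ^ N : NNReal) := by
    rw [← himg, measure_image_mul_left_eq (p := p) _ hπ0, ballHaar_closedBall, mul_one]
  have hcπ : c = ‖π‖ ^ N := by rw [hc, hball]; simp
  have hint : ∀ S : Set F, S ⊆ B → IntegrableOn (fun a : F => ‖a‖ ^ (N * r)) S (ballHaar F) :=
    fun S hS => IntegrableOn.mono_set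
      ((continuous_norm.pow _).continuousOn.integrableOn_compact (isCompact_closedBall _ _)) hS
  have hdiff : B = Metric.sphere (0 : F) 1 ∪ Metric.ball 0 1 := by
    rw [Set.union_comm, Metric.ball_union_sphere]
  have hsph : ∫ a in Metric.sphere (0 : F) 1, ‖a‖ ^ (N * r) ∂ballHaar F = 1 - c := by
    have h1 : ∫ a in Metric.sphere (0 : F) 1, ‖a‖ ^ (N * r) ∂ballHaar F =
        ∫ a in Metric.sphere (0 : F) 1, (1 : ℝ) ∂ballHaar F := by
      refine setIntegral_congr_fun Metric.isClosed_sphere.measurableSet fun a ha => ?_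
      simp [mem_sphere_zero_iff_norm.1 ha]
    have h2 : Metric.sphere (0 : F) 1 = B \ Metric.ball 0 1 :=
      Metric.closedBall_sdiff_ball.symm
    rw [h1, setIntegral_const, smul_eq_mul, mul_one, h2, measureReal_sdiff
      Metric.ball_subset_closedBall measurableSet_ball
      (isCompact_closedBall _ _).measure_lt_top.ne, measureReal_def, measureReal_def,
      ballHaar_closedBall, hc, ENNReal.toReal_one]
  set I := ∫ a in B, ‖a‖ ^ (N * r) ∂ballHaar F
  -- Rescaling by π contributes a factor c from the measure and c^r from the integrand.
  have hbint : ∫ a in Metric.ball (0 : F) 1, ‖a‖ ^ (N * r) ∂ballHaar F = c ^ (r + 1) * I := by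
    have hmeas : Measurable (π * · : F → F) := (continuous_const_mul π).measurable
    have hmap : (ballHaar F).restrict (Metric.ball 0 1) =
        (‖π‖₊ ^ N : NNReal) • ((ballHaar F).restrict B).map (π * ·) := by
      ext S hS
      rw [Measure.restrict_apply hS, Measure.smul_apply, Measure.map_apply hmeas hS,
        Measure.restrict_apply (hmeas hS), ENNReal.smul_def, smul_eq_mul,
        ← measure_image_mul_left_eq (p := p) _ hπ0, ← himg, Set.image_preimage_inter]
    have hcont : Continuous fun t : F => ‖t‖ ^ (N * r) := continuous_norm.pow _
    rw [hmap, integral_smul_nnreal_measure, integral_map hmeas.aemeasurable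
      hcont.aestronglyMeasurable]
    simp only [norm_mul, mul_pow, integral_const_mul]
    rw [NNReal.smul_def, smul_eq_mul, NNReal.coe_pow, coe_nnnorm, ← hcπ, pow_mul, ← hcπ]
    ring
  have hI : I = (1 - c) + c ^ (r + 1) * I := by
    have h1 : I = ∫ a in Metric.sphere (0 : F) 1 ∪ Metric.ball 0 1,
        ‖a‖ ^ (N * r) ∂ballHaar F := by rw [← hdiff]
    rw [setIntegral_union Metric.sphere_disjoint_ball measurableSet_ball
      (hint _ Metric.sphere_subset_closedBall) (hint _ Metric.ball_subset_closedBall), hsph,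
      hbint] at h1
    exact h1
  refine ⟨hcπ ▸ pow_lt_one₀ (norm_nonneg _) hπ1 hN, ?_⟩
  linear_combination hI

end Uniformizer

/-! ### Existence of an integral basis -/

section IntegerRing

variable {p : ℕ} [Fact p.Prime]

theorem mem_integerRing_iff {F : Type*} [NormedField F] [NormedAlgebra ℚ_[p] F]
    [FiniteDimensional ℚ_[p] F] {x : F} : x ∈ integerRing p F ↔ ‖x‖ ≤ 1 := by
  rw [NormedAlgebra.norm_eq_spectralNorm ℚ_[p]]
  rfl

theorem coe_integerRing {F : Type*} [NormedField F] [NormedAlgebra ℚ_[p] F]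
    [FiniteDimensional ℚ_[p] F] : (integerRing p F : Set F) = Metric.closedBall 0 1 := by
  ext x
  rw [SetLike.mem_coe, mem_integerRing_iff, mem_closedBall_zero_iff]

variable {F : Type*} [NontriviallyNormedField F] [NormedAlgebra ℚ_[p] F]
  [FiniteDimensional ℚ_[p] F] [ProperSpace F]

/-- A nonzero ideal is an open, hence closed, subgroup of the compact unit ball; an element of
maximal norm divides all the others. -/
theorem isPrincipalIdealRing_integerRing : IsPrincipalIdealRing (integerRing p F) := by
  refine ⟨fun I => ?_⟩
  by_cases hI : I = ⊥
  · rw [hI]; infer_instance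
  obtain ⟨a₀, ha₀, ha₀0⟩ := Submodule.exists_mem_ne_zero_of_ne_bot hI
  let S : AddSubgroup F := I.toAddSubgroup.map (integerRing p F).subtype.toAddMonoidHom
  have hnorm : ∀ a : integerRing p F, ‖(a : F)‖ ≤ 1 := fun a => mem_integerRing_iff.1 a.2
  have ha₀0' : (a₀ : F) ≠ 0 := fun h => ha₀0 (Subtype.ext h)
  have hdvd : ∀ a ∈ I, (a : F) ≠ 0 → ∀ y : F, ‖y‖ ≤ ‖(a : F)‖ →
      ∃ c : integerRing p F, y = c * a := by
    intro a ha ha0 y hy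
    refine ⟨⟨y / a, mem_integerRing_iff.2 ?_⟩, (div_mul_cancel₀ y ha0).symm⟩
    rw [norm_div]
    exact div_le_one_of_le₀ hy (norm_nonneg _)
  have hnhds : (S : Set F) ∈ nhds 0 := by
    refine Filter.mem_of_superset (Metric.closedBall_mem_nhds 0 (norm_pos_iff.2 ha₀0')) ?_
    intro y hy
    obtain ⟨c, rfl⟩ := hdvd a₀ ha₀ ha₀0' y (mem_closedBall_zero_iff.1 hy)
    exact ⟨c * a₀, I.mul_mem_left c ha₀, rfl⟩
  have hS : IsCompact (S : Set F) := by
    refine (isCompact_closedBall (0 : F) 1).of_isClosed_subset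
      (AddSubgroup.isClosed_of_isOpen S (AddSubgroup.isOpen_of_mem_nhds S hnhds)) ?_
    rintro _ ⟨a, -, rfl⟩
    exact mem_closedBall_zero_iff.2 (hnorm a)
  obtain ⟨_, ⟨a, ha, rfl⟩, hmax⟩ := hS.exists_isMaxOn ⟨0, S.zero_mem⟩ continuous_norm.continuousOn
  have hmax' : ∀ y ∈ I, ‖(y : F)‖ ≤ ‖(a : F)‖ := fun y hy => hmax ⟨y, hy, rfl⟩
  have ha0 : (a : F) ≠ 0 :=
    norm_pos_iff.1 ((norm_pos_iff.2 ha₀0').trans_le (hmax' a₀ ha₀))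
  refine ⟨a, le_antisymm (fun y hy => ?_) ?_⟩
  · obtain ⟨c, hc⟩ := hdvd a ha ha0 y (hmax' y hy)
    exact Ideal.mem_span_singleton'.2 ⟨c, Subtype.ext hc.symm⟩
  · exact (Ideal.span_singleton_le_iff_mem I).2 ha

variable {K : Type*} [NormedField K] [NormedAlgebra F K] [FiniteDimensional F K]
  [IsUltrametricDist K]

variable (p F K) in
/-- The ring of integers of `K`, as a module over the ring of integers of `F`. -/
def integerLattice : Submodule (integerRing p F) K where
  carrier := {x | ‖x‖ ≤ 1}
  add_mem' ha hb := (IsUltrametricDist.norm_add_le_max _ _).trans (max_le ha hb)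
  zero_mem' := by simp
  smul_mem' c x hx := by
    change ‖(c : F) • x‖ ≤ 1
    rw [norm_smul]
    exact mul_le_one₀ (mem_integerRing_iff.1 c.2) (norm_nonneg _) hx

/-- Coordinates are bounded on the compact unit ball, so it lies in the span of a rescaled basis and
is finitely generated by noetherianity. It spans since every vector can be scaled into it. -/
theorem isLattice_integerLattice [ProperSpace K] :
    Submodule.IsLattice F (integerLattice p F K) := by
  have := isPrincipalIdealRing_integerRing (p := p) (F := F)
  let b := Module.finBasis F K
  have hcont : Continuous b.equivFun := LinearMap.continuous_of_finiteDimensional b.equivFun.toLinearMap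
  obtain ⟨C, hC⟩ := ((isCompact_closedBall (0 : K) 1).image hcont).isBounded.exists_norm_le
  constructor
  · obtain ⟨c, hc⟩ := NormedField.exists_lt_norm F (max C 0)
    have hc0 : c ≠ 0 := norm_pos_iff.1 ((le_max_right _ _).trans_lt hc)
    have hfin : (Set.range fun i => c • b i).Finite := Set.finite_range _
    have h1 : integerLattice p F K ≤
        Submodule.span (integerRing p F) (Set.range fun i => c • b i) := by
      intro x hx
      have hx' : ‖b.equivFun x‖ ≤ C := hC _ ⟨x, mem_closedBall_zero_iff.2 hx, rfl⟩
      rw [← b.sum_equivFun x]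
      refine sum_mem fun i _ => ?_
      have h2 : ‖c⁻¹ * b.equivFun x i‖ ≤ 1 := by
        rw [norm_mul, norm_inv]
        refine (inv_mul_le_one₀ (norm_pos_iff.2 hc0)).2 ?_
        exact ((norm_le_pi_norm _ i).trans hx').trans ((le_max_left _ _).trans hc.le)
      have h3 : b.equivFun x i • b i =
          (⟨c⁻¹ * b.equivFun x i, mem_integerRing_iff.2 h2⟩ : integerRing p F) • (c • b i) := by
        change _ = (c⁻¹ * b.equivFun x i) • (c • b i)
        rw [smul_smul, mul_right_comm, inv_mul_cancel₀ hc0, one_mul]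
      rw [h3]
      exact Submodule.smul_mem _ _ (Submodule.subset_span ⟨i, rfl⟩)
    have h2 := isNoetherian_span_of_finite (integerRing p F) hfin
    have h3 : IsNoetherian (integerRing p F) (integerLattice p F K) := isNoetherian_of_le h1
    rw [← Module.Finite.iff_fg]
    infer_instance
  · rw [eq_top_iff]
    intro x _
    obtain ⟨c, hc⟩ := NormedField.exists_lt_norm F ‖x‖
    have hc0 : c ≠ 0 := norm_pos_iff.1 ((norm_nonneg x).trans_lt hc)
    rw [← smul_inv_smul₀ hc0 x]
    refine Submodule.smul_mem _ _ (Submodule.subset_span ?_)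
    change ‖c⁻¹ • x‖ ≤ 1
    rw [norm_smul, norm_inv]
    exact (inv_mul_le_one₀ (norm_pos_iff.2 hc0)).2 hc.le

variable (p F K) in
-- A lattice over a principal ideal domain is free. Consequently the default value in `extDiscr` is
-- never taken.
theorem exists_isIntegralBasis [NormedAlgebra ℚ_[p] K] [FiniteDimensional ℚ_[p] K]
    [ProperSpace K] :
    ∃ b : Module.Basis (Fin (Module.finrank F K)) F K, IsIntegralBasis p F K b := by
  have := isPrincipalIdealRing_integerRing (p := p) (F := F)
  have := isLattice_integerLattice (p := p) (F := F) (K := K)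
  let bM := Module.Free.chooseBasis (integerRing p F) (integerLattice p F K)
  let b := bM.extendOfIsLattice F
  have hcard : Fintype.card (Module.Free.ChooseBasisIndex (integerRing p F)
      (integerLattice p F K)) = Module.finrank F K := (Module.finrank_eq_card_basis b).symm
  let f := Fintype.equivFinOfCardEq hcard
  refine ⟨b.reindex f, fun y => ?_⟩
  have hrepr : ∀ y (hy : y ∈ integerLattice p F K) i, b.repr y i = (bM.repr ⟨y, hy⟩ i : F) := by
    intro y hy i
    have h1 := congrArg Subtype.val (bM.sum_repr ⟨y, hy⟩)
    have h2 : y = ∑ j, (bM.repr ⟨y, hy⟩ j : F) • b j := by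
      refine h1.symm.trans ?_
      simp only [b, Module.Basis.extendOfIsLattice_apply]
      rw [AddSubmonoidClass.coe_finsetSum]
      rfl
    conv_lhs => rw [h2]
    rw [b.repr_sum_self fun j => (bM.repr ⟨y, hy⟩ j : F)]
  rw [mem_integerRing_iff]
  constructor
  · intro hy i
    rw [Module.Basis.repr_reindex_apply, hrepr y hy]
    exact (bM.repr ⟨y, hy⟩ _).2
  · intro h
    rw [← (b.reindex f).sum_repr y]
    refine IsUltrametricDist.norm_sum_le_of_forall_le_of_nonneg zero_le_one fun i _ => ?_
    rw [norm_smul]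
    refine mul_le_one₀ (mem_integerRing_iff.1 (h i)) (norm_nonneg _) ?_
    rw [Module.Basis.reindex_apply]
    simp only [b, Module.Basis.extendOfIsLattice_apply]
    exact (bM _).2

end IntegerRing

/-! ### Indices as volumes -/

section Index

variable {p : ℕ} [Fact p.Prime]

/-- The open unit ball is the maximal ideal, whose index in the ring of integers is q. -/
theorem residueCard_mul_measure_ball {F : Type*} [NormedField F] [NormedAlgebra ℚ_[p] F]
    [FiniteDimensional ℚ_[p] F] [IsUltrametricDist F] [ProperSpace F] [MeasurableSpace F]
    [BorelSpace F] :
    (residueCard p F : ℝ) * (ballHaar F (Metric.ball 0 1)).toReal = 1 := by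
  let O : AddSubgroup F := (integerRing p F).toSubring.toAddSubgroup
  have hO : (O : Set F) = Metric.closedBall 0 1 := coe_integerRing
  let H : AddSubgroup F := (IsUltrametricDist.ball_openAddSubgroup F one_pos).toAddSubgroup
  have hH : (H : Set F) = Metric.ball 0 1 := rfl
  have hHO : H ≤ O := by
    intro x hx
    rw [← SetLike.mem_coe, hO]
    exact Metric.ball_subset_closedBall hx
  have hind : H.relIndex O = residueCard p F := by
    let f : integerRing p F →+ F := (integerRing p F).subtype.toAddMonoidHom
    have h1 : f.range = O := by
      ext x
      constructor
      · rintro ⟨y, rfl⟩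
        exact y.2
      · intro hx
        exact ⟨⟨x, hx⟩, rfl⟩
    have h2 : H.comap f = (IsLocalRing.maximalIdeal (integerRing p F)).toAddSubgroup := by
      ext x
      change (x : F) ∈ (H : Set F) ↔ x ∈ IsLocalRing.maximalIdeal (integerRing p F)
      rw [hH, mem_ball_zero_iff, IsLocalRing.mem_maximalIdeal, mem_nonunits_iff]
      have hx1 : ‖(x : F)‖ ≤ 1 := mem_integerRing_iff.1 x.2
      rw [← not_le, not_iff_not]
      constructor
      · intro h
        have hx0 : (x : F) ≠ 0 := norm_pos_iff.1 (one_pos.trans_le h)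
        have h3 : (x : F)⁻¹ ∈ integerRing p F := by
          rw [mem_integerRing_iff, norm_inv]
          exact inv_le_one_of_one_le₀ h
        exact IsUnit.of_mul_eq_one ⟨(x : F)⁻¹, h3⟩ (Subtype.ext (mul_inv_cancel₀ hx0))
      · intro h
        obtain ⟨y, hy⟩ := h.exists_right_inv
        have h3 : ‖(x : F)‖ * ‖(y : F)‖ = 1 := by
          rw [← norm_mul, ← norm_one (α := F)]
          exact congrArg (fun z : integerRing p F => ‖(z : F)‖) hy
        have h4 : ‖(y : F)‖ ≤ 1 := mem_integerRing_iff.1 y.2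
        calc 1 = ‖(x : F)‖ * ‖(y : F)‖ := h3.symm
          _ ≤ ‖(x : F)‖ := mul_le_of_le_one_right (norm_nonneg _) h4
    rw [← h1, ← AddSubgroup.index_comap, h2]
    rfl
  have h1 := measure_addSubgroup_eq_relIndex_mul (ballHaar F) hHO
    (by rw [hH]; exact measurableSet_ball)
    (relIndex_ne_zero_of_isOpen_of_isCompact (by rw [hH]; exact Metric.isOpen_ball)
      (by rw [hO]; exact isCompact_closedBall _ _))
  rw [hO, hH, ballHaar_closedBall, hind] at h1
  have h2 := congrArg ENNReal.toReal h1
  simpa using h2.symm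

variable {F : Type*} [NontriviallyNormedField F] [NormedAlgebra ℚ_[p] F]
  [FiniteDimensional ℚ_[p] F] [IsUltrametricDist F] [ProperSpace F]
  {K : Type*} [NormedField K] [NormedAlgebra F K] [FiniteDimensional F K]

theorem integerAdjoin_eq_evalLattice {x : K} (hx : Algebra.adjoin F {x} = ⊤) (hx1 : ‖x‖ ≤ 1)
    {m : ℕ} (hm : m + 1 = Module.finrank F K) :
    (integerAdjoin p F x : Set K) =
      evalCoeff x m '' Metric.closedBall (0 : Fin (m + 1) → F) 1 := by
  have hdeg : (minpoly F x).natDegree ≤ m + 1 := by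
    rw [natDegree_minpoly_of_adjoin_eq_top hx, hm]
  ext y
  constructor
  · intro hy
    rw [SetLike.mem_coe, integerAdjoin, Algebra.adjoin_singleton_eq_range_aeval] at hy
    obtain ⟨P, rfl⟩ := hy
    change aeval x P ∈ evalLattice F x m
    rw [aeval_eq_sum_range]
    refine sum_mem fun i _ => ?_
    rw [Algebra.smul_def]
    exact algebraMap_mul_mem_evalLattice (c := (P.coeff i : F))
      (mem_integerRing_iff.1 (P.coeff i).2) (pow_mem_evalLattice hx1 hdeg i)
  · rintro ⟨a, ha, rfl⟩
    rw [mem_closedBall_zero_iff, pi_norm_le_iff_of_nonneg zero_le_one] at ha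
    rw [SetLike.mem_coe, evalCoeff_apply]
    have hxm : x ∈ integerAdjoin p F x := Algebra.subset_adjoin (Set.mem_singleton x)
    refine Subalgebra.sum_mem _ fun i _ => Subalgebra.mul_mem _ ?_ (Subalgebra.pow_mem _ hxm _)
    exact (integerAdjoin p F x).algebraMap_mem ⟨a i, mem_integerRing_iff.2 (ha i)⟩

/-- The ring of integers has volume one and is a union of cosets of 𝒪_F[x], which is open because
evaluation in degree less than r is a homeomorphism. -/
theorem integerIndex_mul_latticeVolume [NormedAlgebra ℚ_[p] K] [FiniteDimensional ℚ_[p] K]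
    [IsUltrametricDist K] [ProperSpace K] [MeasurableSpace K] [BorelSpace K]
    {x : K} (hx : Algebra.adjoin F {x} = ⊤) (hx1 : ‖x‖ ≤ 1)
    {m : ℕ} (hm : m + 1 = Module.finrank F K) :
    (integerIndex p F x : ℝ) * latticeVolume F m x = 1 := by
  let O : AddSubgroup K := (integerRing p K).toSubring.toAddSubgroup
  have hO : (O : Set K) = Metric.closedBall 0 1 := coe_integerRing
  let H : AddSubgroup K := (integerAdjoin p F x).toSubring.toAddSubgroup
  have hH : (H : Set K) = evalCoeff x m '' Metric.closedBall (0 : Fin (m + 1) → F) 1 :=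
    integerAdjoin_eq_evalLattice hx hx1 hm
  have hHO : H ≤ O := by
    intro y hy
    rw [← SetLike.mem_coe, hH] at hy
    obtain ⟨a, ha, rfl⟩ := hy
    rw [mem_closedBall_zero_iff, pi_norm_le_iff_of_nonneg zero_le_one] at ha
    rw [← SetLike.mem_coe, hO, mem_closedBall_zero_iff, evalCoeff_apply]
    refine IsUltrametricDist.norm_sum_le_of_forall_le_of_nonneg zero_le_one fun i _ => ?_
    rw [norm_mul, norm_algebraMap', norm_pow]
    exact mul_le_one₀ (ha i) (by positivity) (pow_le_one₀ (norm_nonneg _) hx1)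
  have hinj := evalCoeff_injective hx (m := m) (by omega)
  let φ : (Fin (m + 1) → F) ≃L[F] K := (LinearEquiv.ofInjectiveOfFinrankEq (evalCoeff x m) hinj
    (by simp [hm])).toContinuousLinearEquiv
  have hnhds : (H : Set K) ∈ nhds 0 := by
    rw [hH]
    have h1 := φ.toHomeomorph.isOpenMap.image_mem_nhds
      (Metric.closedBall_mem_nhds (0 : Fin (m + 1) → F) one_pos)
    have h2 : φ.toHomeomorph 0 = 0 := φ.map_zero
    rw [h2] at h1
    exact h1
  have h1 := measure_addSubgroup_eq_relIndex_mul (ballHaar K) hHO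
    (by rw [hH]; exact (isCompact_evalCoeff_image x m).measurableSet)
    (relIndex_ne_zero_of_isOpen_of_isCompact (AddSubgroup.isOpen_of_mem_nhds H hnhds)
      (by rw [hO]; exact isCompact_closedBall _ _))
  rw [hO, hH, ballHaar_closedBall] at h1
  have h2 := congrArg ENNReal.toReal h1
  rw [ENNReal.toReal_mul, ENNReal.toReal_one, ENNReal.toReal_natCast] at h2
  exact h2.symm

end Index

/-! ### Independence of the discriminant norm from the basis -/

section Discriminant

variable {p : ℕ} [Fact p.Prime]

theorem extNorm_eq_norm_pow {F K : Type*} [Field F] [Algebra ℚ_[p] F] [NormedField K]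
    [NormedAlgebra ℚ_[p] K] [FiniteDimensional ℚ_[p] K] (x : K) :
    extNorm p F x = ‖x‖ ^ Module.finrank ℚ_[p] F := by
  rw [extNorm, ← NormedAlgebra.norm_eq_spectralNorm ℚ_[p]]

theorem norm_det_le_one {F : Type*} [NormedField F] [IsUltrametricDist F] {ι : Type*} [Fintype ι]
    [DecidableEq ι] {M : Matrix ι ι F} (hM : ∀ i j, ‖M i j‖ ≤ 1) : ‖M.det‖ ≤ 1 := by
  rw [Matrix.det_apply]
  refine IsUltrametricDist.norm_sum_le_of_forall_le_of_nonneg zero_le_one fun σ _ => ?_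
  rw [Units.smul_def, zsmul_eq_mul, norm_mul, norm_prod]
  refine mul_le_one₀ ?_ (by positivity) (Finset.prod_le_one (fun _ _ => norm_nonneg _)
    fun i _ => hM _ _)
  rcases Int.units_eq_one_or (Equiv.Perm.sign σ) with h | h <;> simp [h]

/-- The discriminants differ by the square of a determinant with integral entries. Exchanging the
bases gives equality. -/
theorem norm_discr_le_of_isIntegralBasis {F : Type*} [NormedField F] [NormedAlgebra ℚ_[p] F]
    [FiniteDimensional ℚ_[p] F] [IsUltrametricDist F] {K : Type*} [Field K] [Algebra ℚ_[p] K]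
    [FiniteDimensional ℚ_[p] K] [Algebra F K]
    {b b' : Module.Basis (Fin (Module.finrank F K)) F K} (hb : IsIntegralBasis p F K b)
    (hb' : IsIntegralBasis p F K b') : ‖Algebra.discr F b'‖ ≤ ‖Algebra.discr F b‖ := by
  have hmem : ∀ i, b' i ∈ integerRing p K := by
    intro i
    refine (hb' (b' i)).2 fun j => ?_
    rw [Module.Basis.repr_self, Finsupp.single_apply]
    split_ifs
    exacts [one_mem _, zero_mem _]
  have h1 : Algebra.discr F b' = (b.toMatrix b').det ^ 2 * Algebra.discr F b := by
    rw [← Algebra.discr_of_matrix_vecMul, Module.Basis.toMatrix_map_vecMul]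
  rw [h1, norm_mul, norm_pow]
  refine mul_le_of_le_one_left (norm_nonneg _) (pow_le_one₀ (norm_nonneg _)
    (norm_det_le_one fun i j => ?_))
  exact mem_integerRing_iff.1 ((hb (b' j)).1 (hmem j) i)

end Discriminant

/-! ### The density function: uniform formula and its consequences -/

section Density

/-- The moment of order `e` of the `p`-adic absolute value at `x` of a random integral polynomial
of degree at most `m`. -/
def padicMoment (p : ℕ) [Fact p.Prime] (F : Type*) [Field F] [Algebra ℚ_[p] F]
    [FiniteDimensional ℚ_[p] F] {K : Type*} [Field K] [Algebra ℚ_[p] K] [Algebra F K]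
    (e m : ℕ) (x : K) : ℝ :=
  letI := padicBorel p F
  ∫ a, spectralNorm ℚ_[p] K (aeval x (coeffPoly a)) ^ e ∂polyMeasure p F m

theorem integralDensity_eq (p : ℕ) [Fact p.Prime] (F : Type*) [Field F] [Algebra ℚ_[p] F]
    [FiniteDimensional ℚ_[p] F] {K : Type*} [Field K] [Algebra ℚ_[p] K]
    [FiniteDimensional ℚ_[p] K] [Algebra F K] (n : ℕ) (x : K)
    (h : Module.finrank F K ≤ n ∧ Algebra.adjoin F {x} = ⊤) :
    integralDensity p F n x = extNorm p F (extDiscr p F K) / integerIndex p F x *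
      padicMoment p F (Module.finrank ℚ_[p] F * Module.finrank F K) (n - Module.finrank F K) x := by
  rw [integralDensity, if_pos h, padicMoment]
  simp only [extNorm, ← pow_mul]

theorem adjoin_inv_eq_top_iff {F K : Type*} [Field F] [Field K] [Algebra F K]
    [Algebra.IsAlgebraic F K] {x : K} :
    Algebra.adjoin F {x⁻¹} = ⊤ ↔ Algebra.adjoin F {x} = ⊤ := by
  have key : ∀ y : K, Algebra.adjoin F {y} = ⊤ → Algebra.adjoin F {y⁻¹} = ⊤ := by
    intro y hy
    have hmem : y ∈ Algebra.adjoin F {y⁻¹} := by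
      have h1 := Subalgebra.inv_mem_of_algebraic (A := Algebra.adjoin F {y⁻¹})
        (x := ⟨y⁻¹, Algebra.subset_adjoin rfl⟩) (Algebra.IsAlgebraic.isAlgebraic _)
      simpa using h1
    rw [eq_top_iff, ← hy]
    exact Algebra.adjoin_le (Set.singleton_subset_iff.2 hmem)
  exact ⟨fun h => inv_inv x ▸ key _ h, key x⟩

theorem rootDensity_eq_zero_of_lt (p : ℕ) [Fact p.Prime] {F : Type*} [Field F] [Algebra ℚ_[p] F]
    [FiniteDimensional ℚ_[p] F] {K : Type*} [Field K] [Algebra ℚ_[p] K]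
    [FiniteDimensional ℚ_[p] K] [Algebra F K] {n : ℕ} (hn : n < Module.finrank F K) (x : K) :
    rootDensity p F n x = 0 := by
  simp [rootDensity, integralDensity, hn.not_ge]

theorem rootDensity_eq_zero_of_adjoin_ne_top (p : ℕ) [Fact p.Prime] {F : Type*} [Field F]
    [Algebra ℚ_[p] F] [FiniteDimensional ℚ_[p] F] {K : Type*} [Field K] [Algebra ℚ_[p] K]
    [FiniteDimensional ℚ_[p] K] [Algebra F K] [Algebra.IsAlgebraic F K] (n : ℕ) {x : K}
    (hx : Algebra.adjoin F {x} ≠ ⊤) : rootDensity p F n x = 0 := by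
  have hx' : Algebra.adjoin F {x⁻¹} ≠ ⊤ := fun h => hx (adjoin_inv_eq_top_iff.1 h)
  simp [rootDensity, integralDensity, hx, hx']

theorem extNorm_extDiscr_pos (p : ℕ) [Fact p.Prime] (F : Type*) [NontriviallyNormedField F]
    [NormedAlgebra ℚ_[p] F] [FiniteDimensional ℚ_[p] F] [ProperSpace F] (K : Type*) [NormedField K]
    [NormedAlgebra F K] [FiniteDimensional F K] [NormedAlgebra ℚ_[p] K] [FiniteDimensional ℚ_[p] K]
    [IsUltrametricDist K] [ProperSpace K] : 0 < extNorm p F (extDiscr p F K) := by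
  have : CharZero F := charZero_of_injective_algebraMap (algebraMap ℚ_[p] F).injective
  rw [extNorm_eq_norm_pow]
  refine pow_pos (norm_pos_iff.2 ?_) _
  rw [extDiscr, dif_pos (exists_isIntegralBasis p F K)]
  exact Algebra.discr_not_zero_of_basis _ _

/-- The hypothesis `hmom` states that the given normed and measurable structures compute the
`p`-adic moments; it is discharged in `rootDensity_properties` for the canonical structures. -/
theorem integralDensity_eq_of_adjoin_eq_top {p : ℕ} [Fact p.Prime] {F : Type*} [NontriviallyNormedField F]
    [NormedAlgebra ℚ_[p] F] [FiniteDimensional ℚ_[p] F] [ProperSpace F] [MeasurableSpace F]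
    [BorelSpace F] {K : Type*} [NormedField K] [NormedAlgebra F K] [FiniteDimensional F K]
    [NormedAlgebra ℚ_[p] K] [FiniteDimensional ℚ_[p] K] [IsScalarTower ℚ_[p] F K]
    (hmom : ∀ (e m : ℕ) (x : K), padicMoment p F e m x = moment F e m x) {n : ℕ} {x : K}
    (h : Module.finrank F K ≤ n ∧ Algebra.adjoin F {x} = ⊤) :
    integralDensity p F n x = extNorm p F (extDiscr p F K) / integerIndex p F x *
      moment F (Module.finrank ℚ_[p] K) (n - Module.finrank F K) x := by
  rw [integralDensity_eq p F n x h, hmom, Module.finrank_mul_finrank]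

theorem residueCard_moment_zero {p : ℕ} [Fact p.Prime] {F : Type*} [NontriviallyNormedField F]
    [NormedAlgebra ℚ_[p] F] [FiniteDimensional ℚ_[p] F] [ProperSpace F] [MeasurableSpace F]
    [BorelSpace F] {K : Type*} [NormedField K] [NormedAlgebra F K] [FiniteDimensional F K]
    [NormedAlgebra ℚ_[p] K] [IsUltrametricDist F] [IsScalarTower ℚ_[p] F K]
    (x : K) : 1 < residueCard p F ∧
    moment F (Module.finrank ℚ_[p] K) 0 x =
      ((residueCard p F : ℝ) ^ (Module.finrank F K + 1) -
          (residueCard p F : ℝ) ^ Module.finrank F K) /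
        ((residueCard p F : ℝ) ^ (Module.finrank F K + 1) - 1) := by
  obtain ⟨hc1, hI⟩ := integral_norm_pow_eq (F := F) p (Module.finrank F K) rfl
  have hq := residueCard_mul_measure_ball (p := p) (F := F)
  set c := (ballHaar F (Metric.ball 0 1)).toReal
  set q := residueCard p F
  set r := Module.finrank F K
  have hq0 : (q : ℝ) ≠ 0 := left_ne_zero_of_mul_eq_one hq
  have hqpos : (0 : ℝ) < q := lt_of_le_of_ne (Nat.cast_nonneg _) hq0.symm
  have hcq : c = (q : ℝ)⁻¹ := (inv_eq_of_mul_eq_one_right hq).symm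
  have hq1 : (1 : ℝ) < q := by
    rw [hcq] at hc1
    exact (inv_lt_one₀ hqpos).1 hc1
  refine ⟨by exact_mod_cast hq1, ?_⟩
  have hq2 : (q : ℝ) ^ (r + 1) - 1 ≠ 0 := (sub_pos.2 (one_lt_pow₀ hq1 (by omega))).ne'
  rw [moment_zero_eq, ← Module.finrank_mul_finrank ℚ_[p] F K, eq_div_iff hq2]
  rw [hcq] at hI
  have h1 : ((q : ℝ)⁻¹) ^ (r + 1) * (q : ℝ) ^ (r + 1) = 1 := by
    rw [← mul_pow, inv_mul_cancel₀ hq0, one_pow]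
  have h2 : (q : ℝ)⁻¹ * (q : ℝ) ^ (r + 1) = q ^ r := by
    rw [pow_succ', inv_mul_cancel_left₀ hq0]
  set I := ∫ a in Metric.closedBall (0 : F) 1, ‖a‖ ^ (Module.finrank ℚ_[p] F * r) ∂ballHaar F
  linear_combination (q : ℝ) ^ (r + 1) * hI + I * h1 - h2

/-- Moments increase with the degree, and the one in degree zero is explicit and positive. -/
theorem moment_pos {p : ℕ} [Fact p.Prime] {F : Type*} [NontriviallyNormedField F]
    [NormedAlgebra ℚ_[p] F] [FiniteDimensional ℚ_[p] F] [IsUltrametricDist F] [ProperSpace F]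
    [MeasurableSpace F] [BorelSpace F] {K : Type*} [NormedField K] [NormedAlgebra F K]
    [FiniteDimensional F K] [NormedAlgebra ℚ_[p] K] [IsScalarTower ℚ_[p] F K]
    [IsUltrametricDist K] (m : ℕ) (x : K) : 0 < moment F (Module.finrank ℚ_[p] K) m x := by
  have h0 : moment F (Module.finrank ℚ_[p] K) 0 x ≤ moment F (Module.finrank ℚ_[p] K) m x := by
    induction m with
    | zero => exact le_rfl
    | succ m ih => exact ih.trans (moment_le_moment_succ _ m x)
  refine lt_of_lt_of_le ?_ h0
  obtain ⟨hq, h⟩ := residueCard_moment_zero (p := p) (F := F) x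
  have hq' : (1 : ℝ) < residueCard p F := by exact_mod_cast hq
  rw [h]
  exact div_pos (sub_pos.2 (pow_lt_pow_right₀ hq' (Nat.lt_succ_self _)))
    (sub_pos.2 (one_lt_pow₀ hq' (by omega)))

theorem rootDensity_finrank {p : ℕ} [Fact p.Prime] {F : Type*} [NontriviallyNormedField F]
    [NormedAlgebra ℚ_[p] F] [FiniteDimensional ℚ_[p] F] [IsUltrametricDist F] [ProperSpace F]
    [MeasurableSpace F] [BorelSpace F] {K : Type*} [NormedField K] [NormedAlgebra F K]
    [FiniteDimensional F K] [NormedAlgebra ℚ_[p] K] [IsScalarTower ℚ_[p] F K]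
    [FiniteDimensional ℚ_[p] K]
    (hmom : ∀ (e m : ℕ) (x : K), padicMoment p F e m x = moment F e m x) {x : K}
    (htop : Algebra.adjoin F {x} = ⊤) (hx : x ∈ integerRing p K) :
    rootDensity p F (Module.finrank F K) x =
      extNorm p F (extDiscr p F K) * (1 / (integerIndex p F x : ℝ)) *
        (((residueCard p F : ℝ) ^ (Module.finrank F K + 1) -
          (residueCard p F : ℝ) ^ Module.finrank F K) /
            ((residueCard p F : ℝ) ^ (Module.finrank F K + 1) - 1)) := by
  rw [rootDensity, if_pos hx, integralDensity_eq_of_adjoin_eq_top hmom ⟨le_rfl, htop⟩,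
    Nat.sub_self, (residueCard_moment_zero x).2, mul_one_div]

variable {p : ℕ} [Fact p.Prime] {F : Type*} [NontriviallyNormedField F] [NormedAlgebra ℚ_[p] F]
  [FiniteDimensional ℚ_[p] F] [IsUltrametricDist F] [ProperSpace F]
  {K : Type*} [NormedField K] [NormedAlgebra F K] [FiniteDimensional F K]
  [NormedAlgebra ℚ_[p] K] [FiniteDimensional ℚ_[p] K]
  [IsUltrametricDist K] [ProperSpace K]

variable [MeasurableSpace F] [BorelSpace F] [MeasurableSpace K] [BorelSpace K]

variable [IsScalarTower ℚ_[p] F K]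

theorem integralDensity_eq_latticeVolume
    (hmom : ∀ (e m : ℕ) (x : K), padicMoment p F e m x = moment F e m x) {n m : ℕ}
    (hm : m + 1 = Module.finrank F K) (hn : Module.finrank F K ≤ n) {x : K} (hx : ‖x‖ ≤ 1) :
    integralDensity p F n x = extNorm p F (extDiscr p F K) * latticeVolume F m x *
      moment F (Module.finrank ℚ_[p] K) (n - Module.finrank F K) x := by
  by_cases htop : Algebra.adjoin F {x} = ⊤
  · rw [integralDensity_eq p F n x ⟨hn, htop⟩, hmom, Module.finrank_mul_finrank]
    have h1 := integerIndex_mul_latticeVolume (p := p) htop hx hm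
    have h2 : (integerIndex p F x : ℝ) ≠ 0 := left_ne_zero_of_mul_eq_one h1
    rw [div_eq_mul_inv, inv_eq_of_mul_eq_one_right h1]
  · rw [latticeVolume_eq_zero m htop, integralDensity, if_neg fun h => htop h.2]
    simp

/-- A formula for the density function that is uniform in `x`. -/
theorem rootDensity_eq
    (hmom : ∀ (e m : ℕ) (x : K), padicMoment p F e m x = moment F e m x) {n m : ℕ}
    (hm : m + 1 = Module.finrank F K) (hn : Module.finrank F K ≤ n) (x : K) :
    rootDensity p F n x = extNorm p F (extDiscr p F K) * latticeVolume F m x *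
      moment F (Module.finrank ℚ_[p] K) (n - Module.finrank F K) x /
        max 1 ‖x‖ ^ (Module.finrank ℚ_[p] K * (n + 1)) := by
  set e := Module.finrank ℚ_[p] K with he
  rcases le_or_gt ‖x‖ 1 with hx | hx
  · rw [rootDensity, if_pos (mem_integerRing_iff.2 hx), max_eq_left hx, one_pow, div_one,
      integralDensity_eq_latticeVolume hmom hm hn hx]
  · have hx0 : x ≠ 0 := norm_pos_iff.1 (one_pos.trans hx)
    have hxinv : ‖x⁻¹‖ ≤ 1 := by
      rw [norm_inv]
      exact inv_le_one_of_one_le₀ hx.le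
    have hne : algebraMap F K 1 * x + algebraMap F K 0 ≠ 0 := by simpa using hx0
    -- Outside the ring of integers, the density is defined through inversion, which is the
    -- homography of this involutive matrix.
    have hmat : (!![0, 1; 1, 0] : Matrix (Fin 2) (Fin 2) F) * !![0, 1; 1, 0] = 1 := by
      ext i j
      fin_cases i <;> fin_cases j <;> simp
    have hV := latticeVolume_homography p (a := (0 : F)) (b := 1) (c := 1) (d := 0)
      (a' := 0) (b' := 1) (c' := 1) (d' := 0) (by simp) (by simp) (by simp) (by simp) (by simp)
      (by simp) (by simp) (by simp) hmat m hne
    have hJ := moment_homography p (a := (0 : F)) (b := 1) (c := 1) (d := 0)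
      (a' := 0) (b' := 1) (c' := 1) (d' := 0) (by simp) (by simp) (by simp) (by simp) (by simp)
      (by simp) (by simp) (by simp) hmat e (n - Module.finrank F K) hne
    simp only [map_one, map_zero, one_mul, zero_mul, add_zero, zero_add, one_div] at hV hJ
    rw [rootDensity, if_neg (fun h => hx.not_ge (mem_integerRing_iff.1 h)), max_eq_right hx.le,
      integralDensity_eq_latticeVolume hmom hm hn hxinv, ← hV, ← hJ, extNorm_eq_norm_pow, ← pow_mul,
      ← he]
    have h1 : Module.finrank ℚ_[p] F * (2 * Module.finrank F K) = 2 * e := by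
      rw [he, ← Module.finrank_mul_finrank ℚ_[p] F K]
      ring
    -- The volume contributes m = r - 1 times e, the moment n - r times e, and the defining factor
    -- ‖x‖^(-2r) contributes 2e.
    have h2 : e * (n + 1) = m * e + (n - Module.finrank F K) * e + 2 * e := by
      obtain ⟨k, rfl⟩ := Nat.exists_eq_add_of_le hn
      rw [Nat.add_sub_cancel_left, ← hm]
      ring
    have h3 : ‖x‖ ≠ 0 := norm_ne_zero_iff.2 hx0
    rw [h1, h2, pow_add, pow_add]
    field_simp

theorem rootDensity_homography
    (hmom : ∀ (e m : ℕ) (x : K), padicMoment p F e m x = moment F e m x) (n : ℕ)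
    {a b c d a' b' c' d' : F}
    (ha : ‖a‖ ≤ 1) (hb : ‖b‖ ≤ 1) (hc : ‖c‖ ≤ 1) (hd : ‖d‖ ≤ 1)
    (ha' : ‖a'‖ ≤ 1) (hb' : ‖b'‖ ≤ 1) (hc' : ‖c'‖ ≤ 1) (hd' : ‖d'‖ ≤ 1)
    (h : !![a, b; c, d] * !![a', b'; c', d'] = 1)
    (h' : !![a', b'; c', d'] * !![a, b; c, d] = 1) {x : K}
    (hx : algebraMap F K c * x + algebraMap F K d ≠ 0) :
    rootDensity p F n ((algebraMap F K a * x + algebraMap F K b) /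
        (algebraMap F K c * x + algebraMap F K d)) =
      extNorm p F (algebraMap F K c * x + algebraMap F K d) ^ (2 * Module.finrank F K) *
        rootDensity p F n x := by
  rcases lt_or_ge n (Module.finrank F K) with hn | hn
  · rw [rootDensity_eq_zero_of_lt p hn, rootDensity_eq_zero_of_lt p hn, mul_zero]
  obtain ⟨m, hm⟩ : ∃ m, m + 1 = Module.finrank F K :=
    ⟨Module.finrank F K - 1, Nat.sub_add_cancel Module.finrank_pos⟩
  rw [rootDensity_eq hmom hm hn, rootDensity_eq hmom hm hn,
    ← latticeVolume_homography p ha hb hc hd ha' hb' hc' hd' h' m hx,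
    ← moment_homography p ha hb hc hd ha' hb' hc' hd' h _ _ hx,
    extNorm_eq_norm_pow (algebraMap F K c * x + algebraMap F K d), ← pow_mul]
  set e := Module.finrank ℚ_[p] K with he
  set u := algebraMap F K a * x + algebraMap F K b with hu
  set v := algebraMap F K c * x + algebraMap F K d with hv
  have e00 : a' * a + b' * c = 1 := by simpa using congrFun (congrFun h' 0) 0
  have e01 : a' * b + b' * d = 0 := by simpa using congrFun (congrFun h' 0) 1
  have e10 : c' * a + d' * c = 0 := by simpa using congrFun (congrFun h' 1) 0
  have e11 : c' * b + d' * d = 1 := by simpa using congrFun (congrFun h' 1) 1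
  have f00 := congrArg (algebraMap F K) e00
  have f01 := congrArg (algebraMap F K) e01
  have f10 := congrArg (algebraMap F K) e10
  have f11 := congrArg (algebraMap F K) e11
  simp only [map_add, map_mul, map_one, map_zero] at f00 f01 f10 f11
  have hcomb : ∀ {s t : F} {y z : K}, ‖s‖ ≤ 1 → ‖t‖ ≤ 1 →
      ‖algebraMap F K s * y + algebraMap F K t * z‖ ≤ max ‖z‖ ‖y‖ := by
    intro s t y z hs ht
    refine (IsUltrametricDist.norm_add_le_max _ _).trans ?_
    rw [norm_mul, norm_mul, norm_algebraMap', norm_algebraMap', max_comm]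
    exact max_le_max (mul_le_of_le_one_left (norm_nonneg _) ht)
      (mul_le_of_le_one_left (norm_nonneg _) hs)
  -- An integral matrix does not increase the sup norm of the vector (x, 1); applied to the matrix
  -- and to its inverse, this gives equality.
  have hmax : max ‖v‖ ‖u‖ = max 1 ‖x‖ := by
    apply le_antisymm
    · refine max_le ?_ ?_
      · have h1 := hcomb (y := x) (z := 1) hc hd
        rwa [mul_one, norm_one] at h1
      · have h1 := hcomb (y := x) (z := 1) ha hb
        rwa [mul_one, norm_one] at h1
    · refine max_le ?_ ?_
      · have h1 := hcomb (y := u) (z := v) hc' hd'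
        have h2 : algebraMap F K c' * u + algebraMap F K d' * v = 1 := by
          rw [hu, hv]
          linear_combination x * f10 + f11
        rwa [h2, norm_one] at h1
      · have h1 := hcomb (y := u) (z := v) ha' hb'
        have h2 : algebraMap F K a' * u + algebraMap F K b' * v = x := by
          rw [hu, hv]
          linear_combination x * f00 + f01
        rwa [h2] at h1
  have hv0 : ‖v‖ ≠ 0 := norm_ne_zero_iff.2 hx
  have hmax' : max 1 ‖u / v‖ = max 1 ‖x‖ / ‖v‖ := by
    rw [← hmax, norm_div, ← max_div_div_right (norm_nonneg v), div_self hv0]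
  have hM : max 1 ‖x‖ ≠ 0 := (one_pos.trans_le (le_max_left _ _)).ne'
  have h1 : Module.finrank ℚ_[p] F * (2 * Module.finrank F K) = 2 * e := by
    rw [he, ← Module.finrank_mul_finrank ℚ_[p] F K]
    ring
  have h2 : e * (n + 1) = m * e + (n - Module.finrank F K) * e + 2 * e := by
    obtain ⟨k, rfl⟩ := Nat.exists_eq_add_of_le hn
    rw [Nat.add_sub_cancel_left, ← hm]
    ring
  have h3 : ‖v‖ ^ (e * (n + 1)) =
      ‖v‖ ^ (m * e) * ‖v‖ ^ ((n - Module.finrank F K) * e) * ‖v‖ ^ (2 * e) := by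
    rw [h2, pow_add, pow_add]
  rw [hmax', h1, div_pow, h3]
  field_simp

theorem continuous_rootDensity
    (hmom : ∀ (e m : ℕ) (x : K), padicMoment p F e m x = moment F e m x) (n : ℕ) :
    Continuous fun x : K => rootDensity p F n x := by
  rcases lt_or_ge n (Module.finrank F K) with hn | hn
  · simp_rw [rootDensity_eq_zero_of_lt p hn]
    exact continuous_const
  obtain ⟨m, hm⟩ : ∃ m, m + 1 = Module.finrank F K :=
    ⟨Module.finrank F K - 1, Nat.sub_add_cancel Module.finrank_pos⟩
  simp_rw [rootDensity_eq hmom hm hn]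
  refine ((continuous_const.mul (continuous_latticeVolume p hm)).mul
    (continuous_moment _ _)).div (by fun_prop) fun x => ?_
  exact pow_ne_zero _ (one_pos.trans_le (le_max_left _ _)).ne'

/-- Once n ≥ r, the prefactor is positive and independent of n, so only the moments of degrees n - r
and n + 1 - r are compared. They differ exactly when n + 1 - r < r. -/
theorem integralDensity_le_succ
    (hmom : ∀ (e m : ℕ) (x : K), padicMoment p F e m x = moment F e m x) (n : ℕ) {x : K}
    (hx : ‖x‖ ≤ 1) : integralDensity p F n x ≤ integralDensity p F (n + 1) x ∧
      (integralDensity p F n x < integralDensity p F (n + 1) x ↔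
        Algebra.adjoin F {x} = ⊤ ∧ Module.finrank F K ≤ n + 1 ∧
          n + 1 < 2 * Module.finrank F K) := by
  have hr : 0 < Module.finrank F K := Module.finrank_pos
  by_cases htop : Algebra.adjoin F {x} = ⊤
  swap
  · simp [integralDensity, htop]
  obtain ⟨m, hm⟩ : ∃ m, m + 1 = Module.finrank F K :=
    ⟨Module.finrank F K - 1, Nat.sub_add_cancel hr⟩
  have hindex : 0 < (integerIndex p F x : ℝ) := lt_of_le_of_ne (Nat.cast_nonneg _)
    (left_ne_zero_of_mul_eq_one (integerIndex_mul_latticeVolume (p := p) htop hx hm)).symm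
  have hC : 0 < extNorm p F (extDiscr p F K) / integerIndex p F x :=
    div_pos (extNorm_extDiscr_pos p F K) hindex
  rcases lt_trichotomy (n + 1) (Module.finrank F K) with hn | hn | hn
  · have h1 : ∀ k, k ≤ n + 1 → integralDensity p F k x = 0 := fun k hk => by
      rw [integralDensity, if_neg fun h => by omega]
    rw [h1 n (by omega), h1 (n + 1) le_rfl]
    exact ⟨le_rfl, fun h => absurd h (lt_irrefl _), fun h => by omega⟩
  -- At n + 1 = r the density passes from zero to a positive value.
  · have h1 : integralDensity p F n x = 0 := by
      rw [integralDensity, if_neg fun h => by omega]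
    rw [h1, integralDensity_eq_of_adjoin_eq_top hmom ⟨hn.ge, htop⟩]
    have h2 := mul_pos hC (moment_pos (p := p) (F := F) (n + 1 - Module.finrank F K) x)
    exact ⟨h2.le, fun _ => ⟨htop, hn.ge, by omega⟩, fun _ => h2⟩
  · rw [integralDensity_eq_of_adjoin_eq_top hmom ⟨Nat.lt_succ_iff.1 hn, htop⟩,
      integralDensity_eq_of_adjoin_eq_top hmom ⟨hn.le, htop⟩,
      Nat.succ_sub (Nat.lt_succ_iff.1 hn), Nat.succ_eq_add_one]
    refine ⟨mul_le_mul_of_nonneg_left (moment_le_moment_succ _ _ x) hC.le, ?_⟩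
    rw [mul_lt_mul_iff_right₀ hC]
    constructor
    · intro h
      refine ⟨htop, hn.le, ?_⟩
      by_contra hcon
      rw [moment_eq_of_finrank_le _ htop hx (by omega)] at h
      exact lt_irrefl _ h
    · rintro ⟨-, -, h⟩
      exact moment_lt_moment_succ Module.finrank_pos.ne' _ (evalCoeff_injective htop (by omega))

theorem rootDensity_le_succ
    (hmom : ∀ (e m : ℕ) (x : K), padicMoment p F e m x = moment F e m x) (n : ℕ) (x : K) :
    rootDensity p F n x ≤ rootDensity p F (n + 1) x ∧
      (rootDensity p F n x < rootDensity p F (n + 1) x ↔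
        Algebra.adjoin F {x} = ⊤ ∧ Module.finrank F K ≤ n + 1 ∧
          n + 1 < 2 * Module.finrank F K) := by
  by_cases hx : x ∈ integerRing p K
  · simp only [rootDensity, if_pos hx]
    exact integralDensity_le_succ hmom n (mem_integerRing_iff.1 hx)
  · have hx1 : 1 < ‖x‖ := not_le.1 fun h => hx (mem_integerRing_iff.2 h)
    have hxinv : ‖x⁻¹‖ ≤ 1 := by
      rw [norm_inv]
      exact inv_le_one_of_one_le₀ hx1.le
    have hC : 0 < (extNorm p F x ^ (2 * Module.finrank F K))⁻¹ := by
      rw [extNorm_eq_norm_pow]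
      have : 0 < ‖x‖ := one_pos.trans hx1
      positivity
    obtain ⟨h1, h2⟩ := integralDensity_le_succ hmom n hxinv
    -- The factor relating x to its inverse does not depend on n, and both elements generate the
    -- same subalgebra condition.
    rw [adjoin_inv_eq_top_iff] at h2
    simp only [rootDensity, if_neg hx]
    exact ⟨mul_le_mul_of_nonneg_left h1 hC.le, (mul_lt_mul_iff_right₀ hC).trans h2⟩

/-- Since n - r ≥ r - 1, the moment equals the one in degree r - 1, the average over 𝒪_F[x];
multiplying by the volume gives the integral. -/
theorem rootDensity_of_two_mul_finrank_le
    (hmom : ∀ (e m : ℕ) (x : K), padicMoment p F e m x = moment F e m x)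
    (hadj : ∀ x : K, adjoinIntegral p F x = ∫ t in (integerAdjoin p F x : Set K),
      (‖t‖ ^ Module.finrank ℚ_[p] F) ^ Module.finrank F K ∂ballHaar K) {x : K}
    (htop : Algebra.adjoin F {x} = ⊤) (hx : x ∈ integerRing p K) {n : ℕ}
    (hn : 2 * Module.finrank F K - 1 ≤ n) :
    rootDensity p F n x = extNorm p F (extDiscr p F K) * adjoinIntegral p F x := by
  have hr : 0 < Module.finrank F K := Module.finrank_pos
  obtain ⟨m, hm⟩ : ∃ m, m + 1 = Module.finrank F K :=
    ⟨Module.finrank F K - 1, Nat.sub_add_cancel hr⟩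
  have hx1 := mem_integerRing_iff.1 hx
  rw [rootDensity, if_pos hx, integralDensity_eq_latticeVolume hmom hm (by omega) hx1, hadj,
    moment_eq_moment_of_finrank_le _ htop hx1 hm.ge (by omega), mul_assoc,
    latticeVolume_mul_moment _ htop hm, integerAdjoin_eq_evalLattice htop hx1 hm]
  simp only [← pow_mul, Module.finrank_mul_finrank]

end Density

/-! ### Invariance under isomorphisms -/

section Invariance

theorem adjoin_algEquiv_eq_top_iff {F K L : Type*} [Field F] [Field K] [Field L] [Algebra F K]
    [Algebra F L] (σ : K ≃ₐ[F] L) (x : K) :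
    Algebra.adjoin F {σ x} = ⊤ ↔ Algebra.adjoin F {x} = ⊤ := by
  have h1 : Algebra.adjoin F {σ x} = (Algebra.adjoin F {x}).map σ.toAlgHom := by
    rw [AlgHom.map_adjoin_singleton]
    rfl
  have h2 : (⊤ : Subalgebra F L) = (⊤ : Subalgebra F K).map σ.toAlgHom := by
    rw [Algebra.map_top, eq_comm]
    exact (AlgHom.range_eq_top _).2 σ.surjective
  rw [h1, h2]
  exact (Subalgebra.map_injective (f := σ.toAlgHom) σ.injective).eq_iff

variable {p : ℕ} [Fact p.Prime]

variable {F K L : Type*} [Field F] [Algebra ℚ_[p] F] [Field K] [Field L]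
  [Algebra ℚ_[p] K] [Algebra ℚ_[p] L] [Algebra F K] [Algebra F L] [IsScalarTower ℚ_[p] F K]
  [IsScalarTower ℚ_[p] F L]

/-- The spectral norm depends only on the minimal polynomial over ℚ_p. -/
theorem spectralNorm_algEquiv (σ : K ≃ₐ[F] L) (x : K) :
    spectralNorm ℚ_[p] L (σ x) = spectralNorm ℚ_[p] K x := by
  rw [spectralNorm, spectralNorm]
  exact congrArg spectralValue (minpoly.algEquiv_eq (σ.restrictScalars ℚ_[p]) x)

theorem extNorm_algEquiv (σ : K ≃ₐ[F] L) (x : K) : extNorm p F (σ x) = extNorm p F x := by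
  rw [extNorm, extNorm, spectralNorm_algEquiv]

theorem padicMoment_algEquiv [FiniteDimensional ℚ_[p] F] (σ : K ≃ₐ[F] L) (e m : ℕ) (x : K) :
    padicMoment p F e m (σ x) = padicMoment p F e m x := by
  rw [padicMoment, padicMoment]
  have h : ∀ P : F[X], spectralNorm ℚ_[p] L (aeval (σ x) P) =
      spectralNorm ℚ_[p] K (aeval x P) := by
    intro P
    rw [← spectralNorm_algEquiv σ (aeval x P)]
    exact congrArg _ (aeval_algHom_apply σ.toAlgHom x P)
  simp only [h]

variable [FiniteDimensional ℚ_[p] K] [FiniteDimensional ℚ_[p] L]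

theorem algEquiv_mem_integerRing_iff (σ : K ≃ₐ[F] L) (x : K) :
    σ x ∈ integerRing p L ↔ x ∈ integerRing p K := by
  change spectralNorm ℚ_[p] L (σ x) ≤ 1 ↔ spectralNorm ℚ_[p] K x ≤ 1
  rw [spectralNorm_algEquiv]

variable [FiniteDimensional ℚ_[p] F]

theorem integerIndex_algEquiv (σ : K ≃ₐ[F] L) (x : K) :
    integerIndex p F (σ x) = integerIndex p F x := by
  let f : K →+ L := (σ : K ≃+* L).toAddMonoidHom
  have hf : Function.Injective f := σ.injective
  have h1 : (integerRing p L).toSubring.toAddSubgroup =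
      (integerRing p K).toSubring.toAddSubgroup.map f := by
    ext y
    constructor
    · intro hy
      exact ⟨σ.symm y, (algEquiv_mem_integerRing_iff σ _).1 (by simpa using hy), σ.apply_symm_apply y⟩
    · rintro ⟨x, hx, rfl⟩
      exact (algEquiv_mem_integerRing_iff σ x).2 hx
  have h2 : (integerAdjoin p F (σ x)).toSubring.toAddSubgroup =
      (integerAdjoin p F x).toSubring.toAddSubgroup.map f := by
    let τ : K →ₐ[integerRing p F] L := (σ.restrictScalars (integerRing p F)).toAlgHom
    have h3 : integerAdjoin p F (σ x) = (integerAdjoin p F x).map τ := by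
      rw [integerAdjoin, integerAdjoin, AlgHom.map_adjoin_singleton]
      rfl
    rw [h3]
    rfl
  rw [integerIndex, integerIndex, h1, h2, AddSubgroup.relIndex_map_map_of_injective _ _ hf]

theorem IsIntegralBasis.map_algEquiv (σ : K ≃ₐ[F] L)
    (hrank : Module.finrank F K = Module.finrank F L)
    {b : Module.Basis (Fin (Module.finrank F K)) F K} (hb : IsIntegralBasis p F K b) :
    IsIntegralBasis p F L ((b.map σ.toLinearEquiv).reindex (finCongr hrank)) := by
  intro y
  rw [← σ.apply_symm_apply y, algEquiv_mem_integerRing_iff, hb, (finCongr hrank).forall_congr_left]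
  simp

/-- The bases chosen for the two fields are unrelated. The basis of K is transported to L, with the
same discriminant, and then compared with the one chosen there. -/
theorem extNorm_extDiscr_algEquiv (σ : K ≃ₐ[F] L) :
    extNorm p F (extDiscr p F L) = extNorm p F (extDiscr p F K) := by
  let := padicNormedField p F
  let : NormedAlgebra ℚ_[p] F := spectralNorm.normedAlgebra ℚ_[p] F
  have : IsUltrametricDist F := IsUltrametricDist.of_normedAlgebra ℚ_[p]
  have hrank : Module.finrank F K = Module.finrank F L := σ.toLinearEquiv.finrank_eq
  by_cases hK : ∃ b : Module.Basis (Fin (Module.finrank F K)) F K, IsIntegralBasis p F K b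
  · have hL : ∃ b : Module.Basis (Fin (Module.finrank F L)) F L, IsIntegralBasis p F L b :=
      ⟨_, hK.choose_spec.map_algEquiv σ hrank⟩
    have h1 := hK.choose_spec.map_algEquiv σ hrank
    have h2 : Algebra.discr F ((hK.choose.map σ.toLinearEquiv).reindex (finCongr hrank)) =
        Algebra.discr F hK.choose := by
      rw [Module.Basis.coe_reindex, Algebra.discr_reindex, Algebra.discr_eq_discr_of_algEquiv _ σ]
      rfl
    rw [extDiscr, extDiscr, dif_pos hK, dif_pos hL, ← h2, extNorm_eq_norm_pow, extNorm_eq_norm_pow,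
      le_antisymm (norm_discr_le_of_isIntegralBasis h1 hL.choose_spec)
        (norm_discr_le_of_isIntegralBasis hL.choose_spec h1)]
  · have hL : ¬ ∃ b : Module.Basis (Fin (Module.finrank F L)) F L, IsIntegralBasis p F L b := by
      rintro ⟨b, hb⟩
      exact hK ⟨_, hb.map_algEquiv σ.symm hrank.symm⟩
    rw [extDiscr, extDiscr, dif_neg hK, dif_neg hL]

theorem integralDensity_algEquiv (σ : K ≃ₐ[F] L) (n : ℕ) (x : K) :
    integralDensity p F n (σ x) = integralDensity p F n x := by
  have hrank : Module.finrank F L = Module.finrank F K := σ.symm.toLinearEquiv.finrank_eq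
  by_cases h : Module.finrank F K ≤ n ∧ Algebra.adjoin F {x} = ⊤
  · have h' : Module.finrank F L ≤ n ∧ Algebra.adjoin F {σ x} = ⊤ := by
      rwa [hrank, adjoin_algEquiv_eq_top_iff]
    rw [integralDensity_eq p F n x h, integralDensity_eq p F n (σ x) h', hrank,
      extNorm_extDiscr_algEquiv σ, integerIndex_algEquiv, padicMoment_algEquiv]
  · have h' : ¬ (Module.finrank F L ≤ n ∧ Algebra.adjoin F {σ x} = ⊤) := by
      rwa [hrank, adjoin_algEquiv_eq_top_iff]
    rw [integralDensity, integralDensity, if_neg h, if_neg h']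

theorem rootDensity_algEquiv (σ : K ≃ₐ[F] L) (n : ℕ) (x : K) :
    rootDensity p F n (σ x) = rootDensity p F n x := by
  have hrank : Module.finrank F L = Module.finrank F K := σ.symm.toLinearEquiv.finrank_eq
  have hmem := algEquiv_mem_integerRing_iff (p := p) σ x
  by_cases hx : x ∈ integerRing p K
  · rw [rootDensity, rootDensity, if_pos hx, if_pos (hmem.2 hx), integralDensity_algEquiv]
  · rw [rootDensity, rootDensity, if_neg hx, if_neg fun h => hx (hmem.1 h), ← map_inv₀,
      integralDensity_algEquiv, extNorm_algEquiv, hrank]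

end Invariance

/-! ### Passage to the canonical normed structures -/

section Normalization

theorem rootDensity_properties (p : ℕ) [Fact p.Prime] (F : Type*) [Field F] [Algebra ℚ_[p] F]
    [FiniteDimensional ℚ_[p] F] (K : Type*) [Field K] [Algebra ℚ_[p] K]
    [FiniteDimensional ℚ_[p] K] [Algebra F K] [FiniteDimensional F K] [IsScalarTower ℚ_[p] F K]
    (n : ℕ) :
    (@Continuous K ℝ (padicTopology p K) inferInstance fun x : K => rootDensity p F n x) ∧
    (∀ (a b c d a' b' c' d' : integerRing p F),
      !![a, b; c, d] * !![a', b'; c', d'] = 1 → !![a', b'; c', d'] * !![a, b; c, d] = 1 →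
      ∀ x : K, algebraMap F K c * x + algebraMap F K d ≠ 0 →
      rootDensity p F n ((algebraMap F K a * x + algebraMap F K b) /
          (algebraMap F K c * x + algebraMap F K d)) =
        extNorm p F (algebraMap F K c * x + algebraMap F K d) ^ (2 * Module.finrank F K) *
          rootDensity p F n x) ∧
    (∀ x : K, rootDensity p F n x ≤ rootDensity p F (n + 1) x ∧
      (rootDensity p F n x < rootDensity p F (n + 1) x ↔
        Algebra.adjoin F {x} = ⊤ ∧ Module.finrank F K ≤ n + 1 ∧
          n + 1 < 2 * Module.finrank F K)) ∧
    (∀ x : K, Algebra.adjoin F {x} = ⊤ → x ∈ integerRing p K →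
      rootDensity p F (Module.finrank F K) x =
        extNorm p F (extDiscr p F K) * (1 / (integerIndex p F x : ℝ)) *
          (((residueCard p F : ℝ) ^ (Module.finrank F K + 1) -
            (residueCard p F : ℝ) ^ Module.finrank F K) /
              ((residueCard p F : ℝ) ^ (Module.finrank F K + 1) - 1)) ∧
      (2 * Module.finrank F K - 1 ≤ n →
        rootDensity p F n x = extNorm p F (extDiscr p F K) * adjoinIntegral p F x)) := by
  let : NontriviallyNormedField F := spectralNorm.nontriviallyNormedField ℚ_[p] F
  let : NormedAlgebra ℚ_[p] F := spectralNorm.normedAlgebra ℚ_[p] F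
  let : MeasurableSpace F := padicBorel p F
  have : BorelSpace F := ⟨rfl⟩
  have : IsUltrametricDist F := IsUltrametricDist.of_normedAlgebra ℚ_[p]
  have : ProperSpace F := FiniteDimensional.proper ℚ_[p] F
  let : NontriviallyNormedField K := spectralNorm.nontriviallyNormedField ℚ_[p] K
  let : NormedAlgebra ℚ_[p] K := spectralNorm.normedAlgebra ℚ_[p] K
  let : NormedAlgebra F K := spectralNorm.normedAlgebra' ℚ_[p] F K
  let : MeasurableSpace K := padicBorel p K
  have : BorelSpace K := ⟨rfl⟩
  have : IsUltrametricDist K := IsUltrametricDist.of_normedAlgebra ℚ_[p]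
  have : ProperSpace K := FiniteDimensional.proper ℚ_[p] K
  -- With the spectral norms installed, the two sides differ only in writing the ring of integers of
  -- F as the closed unit ball.
  have hmom : ∀ (e m : ℕ) (x : K), padicMoment p F e m x = moment F e m x := by
    intro e m x
    have h : polyMeasure p F m = coeffHaar F (Fin (m + 1)) := by
      rw [polyMeasure, coe_integerRing]
      rfl
    rw [padicMoment, h]
    rfl
  have hadj : ∀ x : K, adjoinIntegral p F x = ∫ t in (integerAdjoin p F x : Set K),
      (‖t‖ ^ Module.finrank ℚ_[p] F) ^ Module.finrank F K ∂ballHaar K := fun _ => rfl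
  refine ⟨continuous_rootDensity hmom n, ?_, rootDensity_le_succ hmom n, fun x htop hx =>
    ⟨rootDensity_finrank hmom htop hx, rootDensity_of_two_mul_finrank_le hmom hadj htop hx⟩⟩
  intro a b c d a' b' c' d' h h' x hx
  have hnorm : ∀ y : integerRing p F, ‖(y : F)‖ ≤ 1 := fun y => mem_integerRing_iff.1 y.2
  have hmap : ∀ {s t u v s' t' u' v' : integerRing p F},
      !![s, t; u, v] * !![s', t'; u', v'] = 1 →
      (!![(s : F), t; u, v] * !![(s' : F), t'; u', v'] : Matrix (Fin 2) (Fin 2) F) = 1 := by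
    intro s t u v s' t' u' v' h
    have h1 := congrArg (integerRing p F).subtype.mapMatrix h
    rw [map_mul, map_one] at h1
    rw [← h1]
    congr 1 <;> ext i j <;> fin_cases i <;> fin_cases j <;> rfl
  exact rootDensity_homography hmom n (hnorm a) (hnorm b) (hnorm c) (hnorm d) (hnorm a')
    (hnorm b') (hnorm c') (hnorm d') (hmap h) (hmap h') hx

end Normalization

end

/-! ### The main theorem -/

theorem theoremB (p : ℕ) [Fact p.Prime]
    (F : Type*) [Field F] [Algebra ℚ_[p] F] [FiniteDimensional ℚ_[p] F]
    (Fbar : Type*) [Field Fbar] [Algebra ℚ_[p] Fbar] [Algebra F Fbar] [IsScalarTower ℚ_[p] F Fbar]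
    [IsAlgClosure F Fbar]
    (n : ℕ) (hn : 0 < n)
    (K : IntermediateField F Fbar) [FiniteDimensional F K]
    (r : ℕ) (hr : r = Module.finrank F K)
    (q : ℕ) (hq : q = residueCard p F) :
    -- vanishing
    (∀ x : K, Algebra.adjoin F {x} ≠ ⊤ ∨ n < r → rootDensity p F n x = 0) ∧
    -- continuity
    (@Continuous K ℝ (padicTopology p K) inferInstance fun x : K => rootDensity p F n x) ∧
    -- invariance under isomorphisms
    (∀ (L : IntermediateField F Fbar) [FiniteDimensional F L] (σ : K ≃ₐ[F] L) (x : K),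
      rootDensity p F n x = rootDensity p F n (σ x)) ∧
    -- transformation under homography
    (∀ (g : GL (Fin 2) (integerRing p F)) (x : K),
      algebraMap F K (g 1 0) * x + algebraMap F K (g 1 1) ≠ 0 →
      rootDensity p F n
          ((algebraMap F K (g 0 0) * x + algebraMap F K (g 0 1)) /
            (algebraMap F K (g 1 0) * x + algebraMap F K (g 1 1))) =
        extNorm p F (algebraMap F K (g 1 0) * x + algebraMap F K (g 1 1)) ^ (2 * r) *
          rootDensity p F n x) ∧
    -- monotony (strict exactly for `r - 1 ≤ n < 2 r - 1`)
    (∀ x : K, rootDensity p F n x ≤ rootDensity p F (n + 1) x ∧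
      (rootDensity p F n x < rootDensity p F (n + 1) x ↔
        Algebra.adjoin F {x} = ⊤ ∧ r ≤ n + 1 ∧ n + 1 < 2 * r)) ∧
    -- formulas for extremal degrees
    (∀ x : K, Algebra.adjoin F {x} = ⊤ → x ∈ integerRing p K →
      rootDensity p F r x =
        extNorm p F (extDiscr p F K) * (1 / (integerIndex p F x : ℝ)) *
          (((q : ℝ) ^ (r + 1) - (q : ℝ) ^ r) / ((q : ℝ) ^ (r + 1) - 1)) ∧
      (2 * r - 1 ≤ n →
        rootDensity p F n x = extNorm p F (extDiscr p F K) * adjoinIntegral p F x)) := by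
  subst hr hq
  obtain ⟨hcont, hhom, hmono, hform⟩ := rootDensity_properties p F K n
  refine ⟨?_, hcont, fun L _ σ x => (rootDensity_algEquiv σ n x).symm, ?_, hmono, hform⟩
  · rintro x (hx | hx)
    · exact rootDensity_eq_zero_of_adjoin_ne_top p n hx
    · exact rootDensity_eq_zero_of_lt p hx x
  · intro g x hx
    have h1 : g.val * g.inv = 1 := g.val_inv
    have h2 : g.inv * g.val = 1 := g.inv_val
    -- The transformation law is available for a matrix and its inverse given by their entries.
    rw [Matrix.eta_fin_two g.val, Matrix.eta_fin_two g.inv] at h1 h2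
    exact hhom _ _ _ _ _ _ _ _ h1 h2 x hx
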